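/- For a complete lattice $L$ let $\Sigma_L$ and $\Sigma'_L$ be its sets of atoms and coatoms, write $\Sigma[a]=\{p\in\Sigma_L : p\le a\}$ for $a\in L$, let $L^{\mathrm{op}}$ be the dual lattice, and for a map $f:L\to M$ of complete lattices let $f^\circ(b)=\bigvee\{a\in L : f(a)\le b\}$. Let $\mathbf{Cal}^0_{\mathbf{Sym}}$ be the category whose objects are the complete atomistic coatomistic lattices $L$ such that both $L$ and $L^{\mathrm{op}}$ satisfy (A$_0$) $\Sigma[x]\cup\Sigma[y]\neq\Sigma$ for all coatoms $x,y$, and whose arrows $f:L\to M$ are the maps that preserve arbitrary joins, send atoms to atoms or $0$, and are such that $f^\circ$ sends coatoms to coatoms or $1$. Put $f^{\mathrm{op}}=f^\circ:M^{\mathrm{op}}\to L^{\mathrm{op}}$. For objects $L_1,L_2$ with atom sets $\Sigma_1,\Sigma_2$ let $\Sigma'_\circledast$ be the set of all $R\subsetneq\Sigma_1\times\Sigma_2$ such that for every $q\in\Sigma_2$ the set $\{p : (p,q)\in R\}$ is of the form $\Sigma[x]$ with $x\in\Sigma'_{L_1}\cup\{1\}$, and for every $p\in\Sigma_1$ the set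 $\{q : (p,q)\in R\}$ is of the form $\Sigma[y]$ with $y\in\Sigma'_{L_2}\cup\{1\}$. Let $L_1\circledast L_2$ be the set of all intersections of families of members of $\Sigma'_\circledast\cup\{\Sigma_1\times\Sigma_2\}$, ordered by inclusion. For arrows $f_i:L_i\to M_i$ ($i=1,2$) let $f_1\circledast f_2: L_1\circledast L_2\to M_1\circledast M_2$ be the join-preserving map that sends an atom $\{(p,q)\}$ to $\{(f_1(p),f_2(q))\}$ if $f_1(p)\ne0$ and $f_2(q)\ne 0$, and to $0$ otherwise. Put $L_1\multimap L_2=(L_1\circledast L_2^{\mathrm{op}})^{\mathrm{op}}$ and $f\multimap g=(f\circledast g^{\mathrm{op}})^{\mathrm{op}}$. Then $\circledast$ and $\multimap$ are bifunctors $\mathbf{Cal}^0_{\mathbf{Sym}}\times\mathbf{Cal}^0_{\mathbf{Sym}}\to\mathbf{Cal}^0_{\mathbf{Sym}}$ and $(\mathbf{Cal}^0_{\mathbf{Sym}})^{\mathrm{op}}\times\mathbf{Cal}^0_{\mathbf{Sym}}\to\mathbf{Cal}^0_{\mathbf{Sym}}$. Theorem. Let $2$ be the two-element lattice. The category $\langle\mathbf{Cal}^0_{\mathbf{Sym}},\circledast,2,\multimap,2\rangle$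 is $*$-autonomous. That is, there are natural associativity, unit and symmetry isomorphisms making $\mathbf{Cal}^0_{\mathbf{Sym}}$ a symmetric monoidal category with tensor bifunctor $\circledast$ and unit $2$; this monoidal category is closed with internal hom bifunctor $\multimap$, i.e. there are bijections $\mathrm{Hom}(A\circledast B,C)\cong\mathrm{Hom}(B,A\multimap C)$, natural in $A$, $B$ and $C$; and $2$ is a dualizing object, i.e. for every object $A$ the canonical arrow $A\to(A\multimap 2)\multimap 2$ (the one that corresponds to the identity of $A\multimap 2$ under $\mathrm{Hom}(A\multimap 2,A\multimap 2)\cong\mathrm{Hom}(A\circledast(A\multimap 2),2)\cong\mathrm{Hom}((A\multimap 2)\circledast A,2)\cong\mathrm{Hom}(A,(A\multimap 2)\multimap 2)$) is an isomorphism. -/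

import Mathlib

open CategoryTheory MonoidalCategory

universe v u

/-! ## Star-autonomous categories -/

/-- In a symmetric monoidal closed category, the canonical arrow `A ⟶ (A ⊸ D) ⊸ D`: it corresponds
to the identity of `A ⊸ D` under
`C(A ⊸ D, A ⊸ D) ≅ C(A ⊗ (A ⊸ D), D) ≅ C((A ⊸ D) ⊗ A, D) ≅ C(A, (A ⊸ D) ⊸ D)`. -/
def toDoubleDual {C : Type u} [Category.{v} C] [MonoidalCategory C] [SymmetricCategory C]
    [MonoidalClosed C] (D A : C) : A ⟶ (ihom ((ihom A).obj D)).obj D :=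
  MonoidalClosed.curry
    ((β_ ((ihom A).obj D) A).hom ≫ MonoidalClosed.uncurry (𝟙 ((ihom A).obj D)))

/-- `⟨C, T, I, H, D⟩` is a `∗`-autonomous category: there are associativity, unit and symmetry
isomorphisms making `C` a symmetric monoidal category with tensor bifunctor `T` and unit `I`, and
adjunctions `A ⊗ - ⊣ H(A, -)` making it closed with internal hom bifunctor `H`, such that the
canonical arrow `A ⟶ H(H(A, D), D)` is an isomorphism for all `A`. -/
def IsStarAutonomous (C : Type u) [Category.{v} C] (T : C × C ⥤ C) (I : C) (H : Cᵒᵖ ⥤ C ⥤ C)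
    (D : C) : Prop :=
  ∃ (_ : MonoidalCategory C) (_ : SymmetricCategory C) (_ : MonoidalClosed C),
    MonoidalCategory.tensor C = T ∧ 𝟙_ C = I ∧ MonoidalClosed.internalHom (C := C) = H ∧
      ∀ A : C, IsIso (toDoubleDual D A)

/-! ## Atoms, coatoms and the adjoint of a map -/

/-- The set of atoms of a lattice. -/
abbrev Atoms (L : Type u) [CompleteLattice L] : Type u := {p : L // IsAtom p}

/-- The set of atoms under `a`. -/
def atomsBelow {L : Type u} [CompleteLattice L] (a : L) : Set (Atoms L) := {p | p.1 ≤ a}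

/-- No two coatoms cover all the atoms. -/
def AxiomA0 (L : Type u) [CompleteLattice L] : Prop :=
  ∀ x y : L, IsCoatom x → IsCoatom y → atomsBelow x ∪ atomsBelow y ≠ Set.univ

/-- `f° b = ⋁ {a | f a ≤ b}`. -/
def circ {L M : Type u} [CompleteLattice L] [CompleteLattice M] (f : L → M) (b : M) : L :=
  sSup {a | f a ≤ b}

theorem circ_gc {L M : Type u} [CompleteLattice L] [CompleteLattice M] (f : sSupHom L M) :
    GaloisConnection f (circ f) := by
  intro a b
  refine ⟨fun h => le_sSup h, fun h => ?_⟩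
  refine (OrderHomClass.mono f h).trans ?_
  rw [circ, map_sSup]
  exact sSup_le (by rintro _ ⟨c, hc, rfl⟩; exact hc)

theorem circ_eq_of_gc {L M : Type u} [CompleteLattice L] [CompleteLattice M] {f : L → M}
    {g : M → L} (h : GaloisConnection f g) : circ f = g := by
  funext b
  refine le_antisymm (sSup_le fun a ha => h.le_iff_le.1 ha) (le_sSup (h.l_u_le b))

theorem atomsBelow_subset {L : Type u} [CompleteLattice L] [IsAtomistic L] {a b : L} :
    atomsBelow a ⊆ atomsBelow b ↔ a ≤ b :=
  ⟨fun h => le_iff_atom_le_imp.2 fun c hc hca => h (a := ⟨c, hc⟩) hca, fun h _ hp => le_trans hp h⟩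

theorem exists_coatom_not_le {L : Type u} [CompleteLattice L] [IsCoatomistic L] {a b : L}
    (h : ¬ b ≤ a) : ∃ x, IsCoatom x ∧ a ≤ x ∧ ¬ b ≤ x := by
  obtain ⟨s, hs, hc⟩ := isGLB_coatoms a
  by_contra! H
  exact h (hs.2 fun x hx => H x (hc x hx) (hs.1 hx))

/-- The dual `f^op : M^op → L^op` of a join-preserving map, given by `f^op b = f° b`. -/
def dualHom {L M : Type u} [CompleteLattice L] [CompleteLattice M] (f : sSupHom L M) :
    sSupHom Mᵒᵈ Lᵒᵈ where
  toFun b := OrderDual.toDual (circ f (OrderDual.ofDual b))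
  map_sSup' s := by exact (circ_gc f).dual.l_sSup.trans sSup_image.symm

theorem circ_dualHom {L M : Type u} [CompleteLattice L] [CompleteLattice M] (f : sSupHom L M) :
    circ (dualHom f) = fun a : Lᵒᵈ => OrderDual.toDual (f (OrderDual.ofDual a)) :=
  circ_eq_of_gc (circ_gc f).dual

theorem circ_id (L : Type u) [CompleteLattice L] : circ (sSupHom.id L) = id :=
  circ_eq_of_gc GaloisConnection.id

theorem circ_comp {L M N : Type u} [CompleteLattice L] [CompleteLattice M] [CompleteLattice N]
    (g : sSupHom M N) (f : sSupHom L M) : circ (g.comp f) = circ f ∘ circ g :=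
  circ_eq_of_gc ((circ_gc f).compose (circ_gc g))

theorem dualHom_id (L : Type u) [CompleteLattice L] :
    dualHom (sSupHom.id L) = sSupHom.id Lᵒᵈ :=
  sSupHom.ext fun b => congrFun (circ_id L) b

theorem dualHom_comp {L M N : Type u} [CompleteLattice L] [CompleteLattice M] [CompleteLattice N]
    (g : sSupHom M N) (f : sSupHom L M) : dualHom (g.comp f) = (dualHom f).comp (dualHom g) :=
  sSupHom.ext fun b => congrFun (circ_comp g f) b

theorem dualHom_atom {L M : Type u} [CompleteLattice L] [CompleteLattice M] {f : sSupHom L M}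
    (hf : ∀ x, IsCoatom x → IsCoatom (circ f x) ∨ circ f x = ⊤) (p : Mᵒᵈ) (hp : IsAtom p) :
    IsAtom (dualHom f p) ∨ dualHom f p = ⊥ :=
  hf (OrderDual.ofDual p) hp

theorem dualHom_coatom {L M : Type u} [CompleteLattice L] [CompleteLattice M] {f : sSupHom L M}
    (hf : ∀ p, IsAtom p → IsAtom (f p) ∨ f p = ⊥) (x : Lᵒᵈ) (hx : IsCoatom x) :
    IsCoatom (circ (dualHom f) x) ∨ circ (dualHom f) x = ⊤ := by
  rw [circ_dualHom]
  exact hf (OrderDual.ofDual x) hx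

/-! ## The category -/

/-- Complete atomistic coatomistic lattices satisfying `AxiomA0` together with their dual. -/
structure CalSym : Type (u + 1) where
  carrier : Type u
  [lat : CompleteLattice carrier]
  [atomistic : IsAtomistic carrier]
  [coatomistic : IsCoatomistic carrier]
  a0 : AxiomA0 carrier
  a0_op : AxiomA0 carrierᵒᵈ

namespace CalSym

instance : CoeSort CalSym.{u} (Type u) := ⟨carrier⟩

attribute [instance] lat atomistic coatomistic

/-- Maps preserving arbitrary joins, sending atoms to atoms or `0`, and such that `f°` sends
coatoms to coatoms or `1`. -/
@[ext]
structure Hom (L M : CalSym.{u}) : Type u where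
  toFun : sSupHom L M
  atom : ∀ p : L, IsAtom p → IsAtom (toFun p) ∨ toFun p = ⊥
  coatom : ∀ x : M, IsCoatom x → IsCoatom (circ toFun x) ∨ circ toFun x = ⊤

theorem Hom.map_le_iff {L M : CalSym.{u}} (f : Hom L M) (a : L) (b : M) :
    f.toFun a ≤ b ↔ a ≤ circ f.toFun b := circ_gc f.toFun a b

theorem Hom.circ_top {L M : CalSym.{u}} (f : Hom L M) : circ f.toFun ⊤ = ⊤ :=
  (circ_gc f.toFun).u_top

/-- The identity. -/
def Hom.id (L : CalSym.{u}) : Hom L L where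
  toFun := sSupHom.id L
  atom p hp := Or.inl hp
  coatom x hx := by
    left
    rw [circ_id]
    exact hx

/-- Composition. -/
def Hom.comp {L M N : CalSym.{u}} (f : Hom L M) (g : Hom M N) : Hom L N where
  toFun := g.toFun.comp f.toFun
  atom p hp := by
    rcases f.atom p hp with h | h
    · exact g.atom _ h
    · right
      rw [sSupHom.comp_apply, h, map_bot]
  coatom x hx := by
    rw [circ_comp]
    rcases g.coatom x hx with h | h
    · exact f.coatom _ h
    · right
      rw [Function.comp_apply, h, f.circ_top]

instance : Category.{u} CalSym.{u} where
  Hom := Hom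
  id := Hom.id
  comp := Hom.comp

/-! ## Duality -/

/-- The dual lattice. -/
abbrev op (L : CalSym.{u}) : CalSym.{u} where
  carrier := Lᵒᵈ
  a0 := L.a0_op
  a0_op := L.a0

/-- The dual of a morphism. -/
def opMap {L M : CalSym.{u}} (f : L ⟶ M) : M.op ⟶ L.op where
  toFun := dualHom (L := L) (M := M) f.toFun
  atom := dualHom_atom (L := L) (M := M) f.coatom
  coatom := dualHom_coatom (L := L) (M := M) f.atom

theorem opMap_id (L : CalSym.{u}) : opMap (𝟙 L) = 𝟙 L.op :=
  Hom.ext (dualHom_id L)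

theorem opMap_comp {L M N : CalSym.{u}} (f : L ⟶ M) (g : M ⟶ N) :
    opMap (f ≫ g) = opMap g ≫ opMap f :=
  Hom.ext (dualHom_comp g.toFun f.toFun)

/-! ## The two-element lattice -/

instance : IsSimpleOrder (ULift.{u} Bool) where
  eq_bot_or_eq_top := by rintro ⟨_ | _⟩ <;> [left; right] <;> rfl

theorem axiomA0_of_isSimpleOrder (L : Type u) [CompleteLattice L] [IsSimpleOrder L] :
    AxiomA0 L := by
  intro x y hx hy h
  have : (⟨⊤, isAtom_top⟩ : Atoms L) ∈ atomsBelow x ∪ atomsBelow y := h ▸ Set.mem_univ _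
  rcases this with h | h
  · exact hx.1 (top_le_iff.1 h)
  · exact hy.1 (top_le_iff.1 h)

/-- The two-element lattice. -/
noncomputable def two : CalSym.{u} where
  carrier := ULift.{u} Bool
  a0 := axiomA0_of_isSimpleOrder _
  a0_op := axiomA0_of_isSimpleOrder _

/-! ## The tensor product of lattices -/

section Tensor

variable (L M : Type u) [CompleteLattice L] [CompleteLattice M]

/-- `Cl(Σ' ∪ {1})`: the sets of atoms under a coatom or under the top. -/
def ClCoatoms : Set (Set (Atoms L)) := {S | ∃ x : L, (IsCoatom x ∨ x = ⊤) ∧ S = atomsBelow x}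

variable {L M} in
/-- `R₁[q] = {p | (p, q) ∈ R}`. -/
def slice₁ (R : Set (Atoms L × Atoms M)) (q : Atoms M) : Set (Atoms L) := {p | (p, q) ∈ R}

variable {L M} in
/-- `R₂[p] = {q | (p, q) ∈ R}`. -/
def slice₂ (R : Set (Atoms L × Atoms M)) (p : Atoms L) : Set (Atoms M) := {q | (p, q) ∈ R}

/-- The proper subsets of `Σ₁ × Σ₂` all of whose slices are in `Cl(Σᵢ' ∪ {1})`. -/
def tensorCoatoms : Set (Set (Atoms L × Atoms M)) :=
  {R | R ≠ Set.univ ∧ (∀ q, slice₁ R q ∈ ClCoatoms L) ∧ (∀ p, slice₂ R p ∈ ClCoatoms M)}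

/-- The underlying set of `L ⊛ M`: all intersections of families of elements of `tensorCoatoms`
and of the full set `Σ₁ × Σ₂`; it is ordered by inclusion. -/
def TensorLat : Type u :=
  {R : Set (Atoms L × Atoms M) //
    ∃ ω : Set (Set (Atoms L × Atoms M)), ω ⊆ tensorCoatoms L M ∪ {Set.univ} ∧ R = ⋂₀ ω}

instance : PartialOrder (TensorLat L M) := inferInstanceAs (PartialOrder (Subtype _))

variable {L M}

theorem TensorLat.sInter_mem (s : Set (TensorLat L M)) :
    ∃ ω : Set (Set (Atoms L × Atoms M)), ω ⊆ tensorCoatoms L M ∪ {Set.univ} ∧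
      (⋂₀ (Subtype.val '' s)) = ⋂₀ ω := by
  refine ⟨{S | S ∈ tensorCoatoms L M ∪ {Set.univ} ∧ ∃ R ∈ s, R.1 ⊆ S}, fun S hS => hS.1, ?_⟩
  apply Set.Subset.antisymm
  · rintro p hp S ⟨_, R, hR, hRS⟩
    exact hRS (hp _ ⟨R, hR, rfl⟩)
  · rintro p hp _ ⟨R, hR, rfl⟩
    obtain ⟨ω, hω, e⟩ := R.2
    rw [e]
    intro S hS
    exact hp S ⟨hω hS, R, hR, e ▸ Set.sInter_subset_of_mem hS⟩

instance : InfSet (TensorLat L M) where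
  sInf s := ⟨⋂₀ (Subtype.val '' s), TensorLat.sInter_mem s⟩

theorem TensorLat.isGLB_sInf (s : Set (TensorLat L M)) : IsGLB s (sInf s) :=
  ⟨fun R hR => Set.sInter_subset_of_mem (Set.mem_image_of_mem _ hR),
    fun R hR => Set.subset_sInter (by rintro _ ⟨S, hS, rfl⟩; exact hR hS)⟩

/-- Meets are intersections. -/
instance : CompleteLattice (TensorLat L M) := completeLatticeOfInf _ TensorLat.isGLB_sInf

/-- The smallest element of `L ⊛ M` containing a given set of pairs. -/
def TensorLat.closure (S : Set (Atoms L × Atoms M)) : TensorLat L M :=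
  sInf {R | S ⊆ R.1}

theorem TensorLat.closure_le {S : Set (Atoms L × Atoms M)} {R : TensorLat L M} :
    TensorLat.closure S ≤ R ↔ S ⊆ R.1 := by
  refine ⟨fun h => Set.Subset.trans ?_ h, fun h => sInf_le h⟩
  exact Set.subset_sInter (by rintro _ ⟨T, hT, rfl⟩; exact hT)

theorem univ_mem_ClCoatoms : Set.univ ∈ ClCoatoms L :=
  ⟨⊤, Or.inr rfl, by ext p; simp [atomsBelow]⟩

theorem mem_coatoms_union {R : Set (Atoms L × Atoms M)} :
    R ∈ tensorCoatoms L M ∪ {Set.univ} ↔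
      (∀ q, slice₁ R q ∈ ClCoatoms L) ∧ (∀ p, slice₂ R p ∈ ClCoatoms M) := by
  constructor
  · rintro (h | rfl)
    · exact h.2
    · exact ⟨fun _ => univ_mem_ClCoatoms, fun _ => univ_mem_ClCoatoms⟩
  · intro h
    by_cases hR : R = Set.univ
    · exact Or.inr hR
    · exact Or.inl ⟨hR, h⟩

/-- An element of `tensorCoatoms` as an element of `L ⊛ M`. -/
def TensorLat.ofCoatom (R : Set (Atoms L × Atoms M))
    (hR : R ∈ tensorCoatoms L M ∪ {Set.univ}) : TensorLat L M :=
  ⟨R, {R}, by simpa using hR, by simp⟩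

theorem TensorLat.coe_top : (⊤ : TensorLat L M).1 = Set.univ :=
  Set.eq_univ_of_univ_subset
    (le_top (a := TensorLat.ofCoatom (Set.univ : Set (Atoms L × Atoms M)) (Or.inr rfl)))

theorem TensorLat.mem_of_forall (R : TensorLat L M) (p : Atoms L × Atoms M)
    (h : ∀ S ∈ tensorCoatoms L M, R.1 ⊆ S → p ∈ S) : p ∈ R.1 := by
  obtain ⟨ω, hω, e⟩ := R.2
  rw [e]
  intro S hS
  rcases hω hS with h' | rfl
  · exact h S h' (e ▸ Set.sInter_subset_of_mem hS)
  · trivial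

/-- `x₁ □ x₂`. -/
def square (x : L) (y : M) : Set (Atoms L × Atoms M) := {p | p.1.1 ≤ x ∨ p.2.1 ≤ y}

theorem square_mem {x : L} {y : M} (hx : IsCoatom x) (hy : IsCoatom y)
    {p : Atoms L × Atoms M} (hp : p ∉ square x y) : square x y ∈ tensorCoatoms L M := by
  refine ⟨fun h => hp (h ▸ Set.mem_univ p), fun q => ?_, fun q => ?_⟩
  · by_cases h : q.1 ≤ y
    · refine ⟨⊤, Or.inr rfl, ?_⟩
      ext r; simp [slice₁, square, atomsBelow, h]
    · refine ⟨x, Or.inl hx, ?_⟩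
      ext r; simp [slice₁, square, atomsBelow, h]
  · by_cases h : q.1 ≤ x
    · refine ⟨⊤, Or.inr rfl, ?_⟩
      ext r; simp [slice₂, square, atomsBelow, h]
    · refine ⟨y, Or.inl hy, ?_⟩
      ext r; simp [slice₂, square, atomsBelow, h]

theorem TensorLat.coatom_mem {R : TensorLat L M} (hR : IsCoatom R) : R.1 ∈ tensorCoatoms L M := by
  by_contra hn
  apply hR.1
  apply Subtype.ext
  rw [TensorLat.coe_top]
  refine Set.eq_univ_of_forall fun p => R.mem_of_forall p fun S hS hRS => ?_
  rcases hR.le_iff.1 (show R ≤ TensorLat.ofCoatom S (Or.inl hS) from hRS) with h | h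
  · have := congrArg Subtype.val h
    rw [TensorLat.coe_top] at this
    exact (show S = Set.univ from this) ▸ Set.mem_univ p
  · exact absurd (h ▸ hS : R.1 ∈ tensorCoatoms L M) hn

theorem not_le_of_ne {p q : Atoms L} (h : q ≠ p) : ¬ q.1 ≤ p.1 := fun hle =>
  h (Subtype.ext ((p.2.le_iff.1 hle).resolve_left q.2.1))

theorem eq_univ_of_ssubset [IsAtomistic L] [IsAtomistic M] (hM : AxiomA0 M) {x y : Set (Atoms L × Atoms M)}
    (hx : x ∈ tensorCoatoms L M) (hy : y ∈ tensorCoatoms L M ∪ {Set.univ}) (h : x ⊂ y) :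
    y = Set.univ := by
  obtain ⟨hy1, hy2⟩ := mem_coatoms_union.1 hy
  obtain ⟨hxy, ⟨p, q⟩, hpy, hpx⟩ := Set.ssubset_iff_exists.1 h
  obtain ⟨a, ha, ea⟩ := hx.2.2 p
  have haq : q ∉ atomsBelow a := ea ▸ hpx
  have hac : IsCoatom a := by
    refine ha.resolve_right fun h => haq ?_
    rw [h]; exact le_top (a := q.1)
  have key : ∀ q' : Atoms M, q' ∉ atomsBelow a → ∀ r, (r, q') ∈ y := by
    obtain ⟨b, -, eb⟩ := hy2 p
    have hab : a ≤ b := by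
      rw [← atomsBelow_subset, ← ea, ← eb]; exact fun q hq => hxy hq
    have hqb : q ∈ atomsBelow b := eb ▸ hpy
    have hb' : b = ⊤ := by
      refine (hac.le_iff.1 hab).resolve_right ?_
      rintro rfl; exact haq hqb
    intro q' hq' r
    by_contra hr
    obtain ⟨c, hc, ec⟩ := hy1 q'
    obtain ⟨d, hd, ed⟩ := hx.2.1 q'
    have hpd : p ∉ atomsBelow d := fun hh => by
      rw [← ed] at hh
      exact hq' (ea ▸ (show q' ∈ slice₂ x p from hh))
    have hpc : p ∈ atomsBelow c := by
      rw [← ec]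
      change q' ∈ slice₂ y p
      rw [eb, hb']; exact le_top (a := q'.1)
    have hrc : r ∉ atomsBelow c := fun hh => hr (by rw [← ec] at hh; exact hh)
    have hdc : d ≤ c := by
      rw [← atomsBelow_subset, ← ed, ← ec]; exact fun t ht => hxy ht
    have hd' : IsCoatom d := by
      refine hd.resolve_right fun h => hpd ?_
      rw [h]; exact le_top (a := p.1)
    rcases hd'.le_iff.1 hdc with h | h
    · rw [h] at hrc; exact hrc (le_top (a := r.1))
    · rw [h] at hpc; exact hpd hpc
  refine Set.eq_univ_of_forall ?_
  rintro ⟨r, s⟩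
  obtain ⟨c, hc, ec⟩ := hy2 r
  have hs : s ∈ atomsBelow c := by
    rcases hc with hc | rfl
    · exfalso
      refine hM a c hac hc (Set.eq_univ_of_forall fun q' => ?_)
      by_cases h' : q' ∈ atomsBelow a
      · exact Or.inl h'
      · exact Or.inr (ec ▸ (show q' ∈ slice₂ y r from key q' h' r))
    · exact le_top (a := s.1)
  rw [← ec] at hs
  exact hs

theorem TensorLat.isCoatom_ofCoatom [IsAtomistic L] [IsAtomistic M] (hM : AxiomA0 M)
    {R : Set (Atoms L × Atoms M)} (hR : R ∈ tensorCoatoms L M) :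
    IsCoatom (TensorLat.ofCoatom R (Or.inl hR)) := by
  refine ⟨fun h => hR.1 ((congrArg Subtype.val h).trans TensorLat.coe_top), fun T hT => ?_⟩
  have hT' : R ⊂ T.1 := hT
  refine Subtype.ext (Eq.trans ?_ TensorLat.coe_top.symm)
  refine Set.eq_univ_of_forall fun p => T.mem_of_forall p fun S hS hTS => ?_
  exact absurd (eq_univ_of_ssubset hM hR (Or.inl hS) (hT'.trans_subset hTS)) hS.1

theorem TensorLat.isCoatomistic [IsAtomistic L] [IsAtomistic M] (hM : AxiomA0 M) :
    IsCoatomistic (TensorLat L M) where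
  isGLB_coatoms R := by
    refine ⟨{S | IsCoatom S ∧ R ≤ S}, ⟨fun S hS => hS.2, ?_⟩, fun S hS => hS.1⟩
    intro T hT p hp
    exact R.mem_of_forall p fun S hS hRS =>
      hT (a := TensorLat.ofCoatom S (Or.inl hS)) ⟨isCoatom_ofCoatom hM hS, hRS⟩ hp

theorem exists_coatom_of_notMem {R : Set (Atoms L × Atoms M)} (hR : R ∈ tensorCoatoms L M) :
    ∃ a : L, IsCoatom a ∧ ∀ r : Atoms L, ¬ r.1 ≤ a →
      ∃ c : M, IsCoatom c ∧ ∀ s : Atoms M, ¬ s.1 ≤ c → (r, s) ∉ R := by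
  obtain ⟨⟨p, q⟩, hpq⟩ := (Set.ne_univ_iff_exists_notMem R).1 hR.1
  obtain ⟨a, ha, ea⟩ := hR.2.1 q
  have hp : p ∉ atomsBelow a := ea ▸ hpq
  refine ⟨a, ha.resolve_right ?_, fun r hr => ?_⟩
  · rintro rfl; exact hp (le_top (a := p.1))
  have hr' : r ∉ slice₁ R q := ea ▸ hr
  obtain ⟨c, hc, ec⟩ := hR.2.2 r
  have hq : q ∉ atomsBelow c := ec ▸ hr'
  refine ⟨c, hc.resolve_right ?_, fun s hs => ?_⟩
  · rintro rfl; exact hq (le_top (a := q.1))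
  have hs' : s ∉ slice₂ R r := ec ▸ hs
  exact hs'

theorem exists_atom_of_axiomA0 (h : AxiomA0 L) {x y : L} (hx : IsCoatom x) (hy : IsCoatom y) :
    ∃ p : Atoms L, ¬ p.1 ≤ x ∧ ¬ p.1 ≤ y := by
  obtain ⟨p, hp⟩ := (Set.ne_univ_iff_exists_notMem _).1 (h x y hx hy)
  exact ⟨p, fun h => hp (Or.inl h), fun h => hp (Or.inr h)⟩

theorem exists_coatom_of_axiomA0 (h : AxiomA0 Lᵒᵈ) {p q : L} (hp : IsAtom p) (hq : IsAtom q) :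
    ∃ x : L, IsCoatom x ∧ ¬ p ≤ x ∧ ¬ q ≤ x := by
  obtain ⟨x, h1, h2⟩ := exists_atom_of_axiomA0 h hp.dual hq.dual
  exact ⟨OrderDual.ofDual x.1, x.2.dual, h1, h2⟩

variable [IsCoatomistic L] [IsCoatomistic M]

theorem exists_square_bot (q : Atoms L × Atoms M) :
    ∃ S ∈ tensorCoatoms L M, q ∉ S := by
  obtain ⟨x, hx, -, hqx⟩ := exists_coatom_not_le (a := ⊥) (b := q.1.1)
    (fun h => q.1.2.1 (le_bot_iff.1 h))
  obtain ⟨y, hy, -, hqy⟩ := exists_coatom_not_le (a := ⊥) (b := q.2.1)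
    (fun h => q.2.2.1 (le_bot_iff.1 h))
  have hq : q ∉ square x y := by rintro (h | h) <;> contradiction
  exact ⟨_, square_mem hx hy hq, hq⟩

theorem exists_square_ne {p q : Atoms L × Atoms M} (h : q ≠ p) :
    ∃ S ∈ tensorCoatoms L M, p ∈ S ∧ q ∉ S := by
  by_cases h1 : q.1 = p.1
  · have h2 : q.2 ≠ p.2 := fun h2 => h (Prod.ext h1 h2)
    obtain ⟨x, hx, -, hqx⟩ := exists_coatom_not_le (a := ⊥) (b := q.1.1)
      (fun h => q.1.2.1 (le_bot_iff.1 h))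
    obtain ⟨y, hy, hpy, hqy⟩ := exists_coatom_not_le (not_le_of_ne h2)
    have hq : q ∉ square x y := by rintro (h | h) <;> contradiction
    exact ⟨_, square_mem hx hy hq, Or.inr hpy, hq⟩
  · obtain ⟨x, hx, hpx, hqx⟩ := exists_coatom_not_le (not_le_of_ne h1)
    obtain ⟨y, hy, -, hqy⟩ := exists_coatom_not_le (a := ⊥) (b := q.2.1)
      (fun h => q.2.2.1 (le_bot_iff.1 h))
    have hq : q ∉ square x y := by rintro (h | h) <;> contradiction
    exact ⟨_, square_mem hx hy hq, Or.inl hpx, hq⟩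

theorem TensorLat.coe_bot : (⊥ : TensorLat L M).1 = ∅ := by
  apply Set.eq_empty_of_forall_notMem
  intro q hq
  obtain ⟨S, hS, hqS⟩ := exists_square_bot q
  exact hqS ((bot_le (a := TensorLat.ofCoatom S (Or.inl hS))) hq)

theorem TensorLat.coe_closure_singleton (p : Atoms L × Atoms M) :
    (TensorLat.closure {p}).1 = {p} := by
  apply Set.Subset.antisymm
  · intro q hq
    by_contra hne
    obtain ⟨S, hS, hpS, hqS⟩ := exists_square_ne hne
    exact hqS (TensorLat.closure_le (R := TensorLat.ofCoatom S (Or.inl hS)).2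
      (Set.singleton_subset_iff.2 hpS) hq)
  · exact TensorLat.closure_le.1 le_rfl

theorem TensorLat.isAtom_closure_singleton (p : Atoms L × Atoms M) :
    IsAtom (TensorLat.closure {p}) := by
  refine ⟨fun h => ?_, fun R hR => ?_⟩
  · have := congrArg Subtype.val h
    rw [TensorLat.coe_closure_singleton, TensorLat.coe_bot] at this
    exact Set.singleton_ne_empty p this
  · have h : R.1 ⊂ (TensorLat.closure {p}).1 := hR
    rw [TensorLat.coe_closure_singleton, Set.ssubset_singleton_iff] at h
    exact Subtype.ext (h.trans TensorLat.coe_bot.symm)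

theorem TensorLat.eq_closure_of_isAtom {a : TensorLat L M} (ha : IsAtom a) :
    ∃ p, a = TensorLat.closure {p} := by
  have hne : a.1.Nonempty := by
    rw [Set.nonempty_iff_ne_empty]
    intro h
    exact ha.1 (Subtype.ext (h.trans TensorLat.coe_bot.symm))
  obtain ⟨p, hp⟩ := hne
  refine ⟨p, ((ha.le_iff.1 (TensorLat.closure_le.2 (Set.singleton_subset_iff.2 hp))).resolve_left
    (TensorLat.isAtom_closure_singleton p).1).symm⟩

instance : IsAtomistic (TensorLat L M) where
  isLUB_atoms R := by
    refine ⟨{a | ∃ p ∈ R.1, a = TensorLat.closure {p}}, ⟨?_, ?_⟩, ?_⟩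
    · rintro _ ⟨p, hp, rfl⟩
      exact TensorLat.closure_le.2 (Set.singleton_subset_iff.2 hp)
    · intro S hS p hp
      exact TensorLat.closure_le.1 (hS ⟨p, hp, rfl⟩) rfl
    · rintro _ ⟨p, hp, rfl⟩
      exact TensorLat.isAtom_closure_singleton p



theorem TensorLat.axiomA0 (hL : AxiomA0 L) (hM : AxiomA0 M) : AxiomA0 (TensorLat L M) := by
  intro X Y hX hY h
  obtain ⟨a, ha, hXa⟩ := exists_coatom_of_notMem (TensorLat.coatom_mem hX)
  obtain ⟨b, hb, hYb⟩ := exists_coatom_of_notMem (TensorLat.coatom_mem hY)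
  obtain ⟨r, hra, hrb⟩ := exists_atom_of_axiomA0 hL ha hb
  obtain ⟨c, hc, hXc⟩ := hXa r hra
  obtain ⟨d, hd, hYd⟩ := hYb r hrb
  obtain ⟨s, hsc, hsd⟩ := exists_atom_of_axiomA0 hM hc hd
  have : (⟨_, TensorLat.isAtom_closure_singleton (r, s)⟩ : Atoms (TensorLat L M)) ∈
      atomsBelow X ∪ atomsBelow Y := h ▸ Set.mem_univ _
  rcases this with h' | h'
  · exact hXc s hsc (TensorLat.closure_le.1 h' rfl)
  · exact hYd s hsd (TensorLat.closure_le.1 h' rfl)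

theorem TensorLat.axiomA0_op [IsAtomistic L] [IsAtomistic M] (hM' : AxiomA0 M)
    (hL : AxiomA0 Lᵒᵈ) (hM : AxiomA0 Mᵒᵈ) : AxiomA0 (TensorLat L M)ᵒᵈ := by
  intro P Q hP hQ h
  obtain ⟨p, hp⟩ := TensorLat.eq_closure_of_isAtom (a := OrderDual.ofDual P) hP.dual
  obtain ⟨q, hq⟩ := TensorLat.eq_closure_of_isAtom (a := OrderDual.ofDual Q) hQ.dual
  obtain ⟨x, hx, hpx, hqx⟩ := exists_coatom_of_axiomA0 hL p.1.2 q.1.2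
  obtain ⟨y, hy, hpy, hqy⟩ := exists_coatom_of_axiomA0 hM p.2.2 q.2.2
  have hps : p ∉ square x y := by rintro (h | h) <;> contradiction
  have hqs : q ∉ square x y := by rintro (h | h) <;> contradiction
  have hS := square_mem hx hy hps
  have : (⟨OrderDual.toDual _, (TensorLat.isCoatom_ofCoatom hM' hS).dual⟩ :
      Atoms (TensorLat L M)ᵒᵈ) ∈ atomsBelow P ∪ atomsBelow Q := h ▸ Set.mem_univ _
  rcases this with h' | h'
  · have h'' : OrderDual.ofDual P ≤ TensorLat.ofCoatom _ (Or.inl hS) := h'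
    rw [hp] at h''
    exact hps (TensorLat.closure_le.1 h'' rfl)
  · have h'' : OrderDual.ofDual Q ≤ TensorLat.ofCoatom _ (Or.inl hS) := h'
    rw [hq] at h''
    exact hqs (TensorLat.closure_le.1 h'' rfl)

end Tensor

/-- The tensor product `L ⊛ M`. -/
def tensorObj (L M : CalSym.{u}) : CalSym.{u} where
  carrier := TensorLat L M
  coatomistic := TensorLat.isCoatomistic M.a0
  a0 := TensorLat.axiomA0 L.a0 M.a0
  a0_op := TensorLat.axiomA0_op M.a0 L.a0_op M.a0_op

section TensorMap

variable {L L' M M' : CalSym.{u}} (f : L ⟶ L') (g : M ⟶ M')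

/-- The union of the sets `Σ[f p] × Σ[g q]` for `(p, q) ∈ S`. Each of them is the singleton of
`(f p, g q)` if `f p ≠ 0` and `g q ≠ 0`, and empty otherwise. -/
def imageSet (S : Set (Atoms L × Atoms M)) : Set (Atoms L' × Atoms M') :=
  {r | ∃ p ∈ S, r.1.1 ≤ f.toFun p.1.1 ∧ r.2.1 ≤ g.toFun p.2.1}

theorem map_eq_bot_or (p : Atoms L) :
    f.toFun p.1 = ⊥ ∨ ∃ p' : Atoms L', f.toFun p.1 = p'.1 :=
  (f.atom p.1 p.2).symm.imp_right fun h => ⟨⟨_, h⟩, rfl⟩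

theorem Atoms.le_iff {L : CalSym.{u}} {p q : Atoms L} : p.1 ≤ q.1 ↔ p = q :=
  ⟨fun h => Subtype.ext ((q.2.le_iff.1 h).resolve_left p.2.1), fun h => h ▸ le_rfl⟩

theorem Atoms.not_le_bot (p : Atoms L) : ¬ p.1 ≤ ⊥ := fun h => p.2.1 (le_bot_iff.1 h)

/-- The largest set whose image is contained in `R`. -/
def preSet (R : Set (Atoms L' × Atoms M')) : Set (Atoms L × Atoms M) :=
  {p | imageSet f g {p} ⊆ R}

theorem imageSet_subset {S : Set (Atoms L × Atoms M)} {R : Set (Atoms L' × Atoms M')} :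
    imageSet f g S ⊆ R ↔ S ⊆ preSet f g R := by
  constructor
  · rintro h p hp r ⟨p', hp', hr⟩
    obtain rfl : p' = p := hp'
    exact h ⟨p', hp, hr⟩
  · rintro h r ⟨p, hp, hr⟩
    exact h hp ⟨p, rfl, hr⟩

theorem circ_mem_ClCoatoms {x : L'} (hx : IsCoatom x ∨ x = ⊤) :
    atomsBelow (circ f.toFun x) ∈ ClCoatoms L := by
  refine ⟨_, ?_, rfl⟩
  rcases hx with hx | rfl
  · exact f.coatom x hx
  · exact Or.inr f.circ_top

theorem preSet_mem {R : Set (Atoms L' × Atoms M')}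
    (hR : R ∈ tensorCoatoms L' M' ∪ {Set.univ}) :
    preSet f g R ∈ tensorCoatoms L M ∪ {Set.univ} := by
  rw [mem_coatoms_union] at hR ⊢
  constructor
  · intro q
    rcases map_eq_bot_or g q with h | ⟨q', h⟩
    · convert univ_mem_ClCoatoms
      refine Set.eq_univ_of_forall fun p => ?_
      rintro r ⟨_, rfl, -, hr⟩
      exact absurd (h ▸ hr) (Atoms.not_le_bot _)
    · obtain ⟨x, hx, ex⟩ := hR.1 q'
      convert circ_mem_ClCoatoms f hx
      ext p
      change imageSet f g {(p, q)} ⊆ R ↔ p.1 ≤ circ f.toFun x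
      rw [← f.map_le_iff, ← atomsBelow_subset (b := x), ← ex]
      constructor
      · intro hs r hr
        exact hs ⟨_, rfl, hr, h.ge⟩
      · rintro hs ⟨r, s⟩ ⟨_, rfl, hr, hs'⟩
        have hsq : s = q' := Atoms.le_iff.1 (hs'.trans h.le)
        exact hsq ▸ hs hr
  · intro p
    rcases map_eq_bot_or f p with h | ⟨p', h⟩
    · convert univ_mem_ClCoatoms
      refine Set.eq_univ_of_forall fun q => ?_
      rintro r ⟨_, rfl, hr, -⟩
      exact absurd (h ▸ hr) (Atoms.not_le_bot _)
    · obtain ⟨y, hy, ey⟩ := hR.2 p'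
      convert circ_mem_ClCoatoms g hy
      ext q
      change imageSet f g {(p, q)} ⊆ R ↔ q.1 ≤ circ g.toFun y
      rw [← g.map_le_iff, ← atomsBelow_subset (b := y), ← ey]
      constructor
      · intro hs s hs'
        exact hs ⟨_, rfl, h.ge, hs'⟩
      · rintro hs ⟨r, s⟩ ⟨_, rfl, hr, hs'⟩
        have hrp : r = p' := Atoms.le_iff.1 (hr.trans h.le)
        exact hrp ▸ hs hs'

theorem preSet_mem_tensorLat (R : TensorLat L' M') :
    ∃ ω : Set (Set (Atoms L × Atoms M)), ω ⊆ tensorCoatoms L M ∪ {Set.univ} ∧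
      preSet f g R.1 = ⋂₀ ω := by
  obtain ⟨ω, hω, e⟩ := R.2
  refine ⟨preSet f g '' ω, ?_, ?_⟩
  · rintro _ ⟨S, hS, rfl⟩
    exact preSet_mem f g (hω hS)
  · ext p
    rw [e, Set.sInter_image, Set.mem_iInter₂]
    exact Set.subset_sInter_iff

/-- The right adjoint of `f ⊛ g`. -/
def tensorPre (R : TensorLat L' M') : TensorLat L M := ⟨preSet f g R.1, preSet_mem_tensorLat f g R⟩

theorem tensor_gc :
    GaloisConnection (fun S : TensorLat L M => TensorLat.closure (imageSet f g S.1))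
      (tensorPre f g) := fun _ _ =>
  TensorLat.closure_le.trans (imageSet_subset f g)

/-- The underlying join-preserving map of `f ⊛ g`, `S ↦ ⋁ {(f p, g q) | (p, q) ∈ S}` where
`(f p, g q)` is read as `0` if `f p = 0` or `g q = 0`. -/
def tensorFun : sSupHom (TensorLat L M) (TensorLat L' M') where
  toFun S := TensorLat.closure (imageSet f g S.1)
  map_sSup' _ := (tensor_gc f g).l_sSup.trans sSup_image.symm

theorem tensorFun_atom (p : TensorLat L M) (hp : IsAtom p) :
    IsAtom (tensorFun f g p) ∨ tensorFun f g p = ⊥ := by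
  obtain ⟨⟨p, q⟩, rfl⟩ := TensorLat.eq_closure_of_isAtom hp
  change IsAtom (TensorLat.closure (imageSet f g (TensorLat.closure {(p, q)}).1)) ∨
    TensorLat.closure (imageSet f g (TensorLat.closure {(p, q)}).1) = ⊥
  rw [TensorLat.coe_closure_singleton]
  rcases map_eq_bot_or f p with h | ⟨p', h⟩
  · right
    rw [← le_bot_iff, TensorLat.closure_le]
    rintro r ⟨_, rfl, hr, -⟩
    exact absurd (h ▸ hr) (Atoms.not_le_bot _)
  rcases map_eq_bot_or g q with h' | ⟨q', h'⟩
  · right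
    rw [← le_bot_iff, TensorLat.closure_le]
    rintro r ⟨_, rfl, -, hr⟩
    exact absurd (h' ▸ hr) (Atoms.not_le_bot _)
  left
  convert TensorLat.isAtom_closure_singleton (p', q')
  ext ⟨r, s⟩
  constructor
  · rintro ⟨_, rfl, hr, hs⟩
    exact Prod.ext (Atoms.le_iff.1 (hr.trans h.le)) (Atoms.le_iff.1 (hs.trans h'.le))
  · rintro ⟨⟩
    exact ⟨_, rfl, h.ge, h'.ge⟩

theorem tensorFun_coatom (x : TensorLat L' M') (hx : IsCoatom x) :
    IsCoatom (circ (tensorFun f g) x) ∨ circ (tensorFun f g) x = ⊤ := by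
  rw [circ_eq_of_gc (f := tensorFun f g) (tensor_gc f g)]
  rcases preSet_mem f g (Or.inl (TensorLat.coatom_mem hx)) with h | h
  · exact Or.inl (TensorLat.isCoatom_ofCoatom M.a0 h)
  · exact Or.inr (Subtype.ext (Eq.trans h TensorLat.coe_top.symm))

/-- The morphism `f ⊛ g`. -/
def tensorMap : tensorObj L M ⟶ tensorObj L' M' where
  toFun := tensorFun f g
  atom := tensorFun_atom f g
  coatom := tensorFun_coatom f g

end TensorMap

/-- A morphism out of `L ⊛ M` is determined by its right adjoint. -/
theorem tensorFun_ext {L M : CalSym.{u}} {N : Type u} [CompleteLattice N]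
    {h k : sSupHom (TensorLat L M) N} (H : circ h = circ k) : h = k :=
  sSupHom.ext fun _ => (circ_gc h).l_unique (circ_gc k) (fun b => congrFun H b)

theorem tensorMap_id (L M : CalSym.{u}) : tensorMap (𝟙 L) (𝟙 M) = 𝟙 (tensorObj L M) := by
  apply Hom.ext
  refine tensorFun_ext (h := tensorFun (𝟙 L) (𝟙 M)) (k := sSupHom.id _) ?_
  rw [circ_eq_of_gc (f := tensorFun (𝟙 L) (𝟙 M)) (tensor_gc _ _), circ_id]
  funext R
  apply Subtype.ext
  ext ⟨p, q⟩
  constructor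
  · intro h
    exact h ⟨_, rfl, le_rfl, le_rfl⟩
  · rintro h ⟨r, s⟩ ⟨_, rfl, hr, hs⟩
    obtain rfl := Atoms.le_iff.1 hr
    obtain rfl := Atoms.le_iff.1 hs
    exact h

theorem tensorMap_comp {L L' L'' M M' M'' : CalSym.{u}} (f : L ⟶ L') (f' : L' ⟶ L'')
    (g : M ⟶ M') (g' : M' ⟶ M'') :
    tensorMap (f ≫ f') (g ≫ g') = tensorMap f g ≫ tensorMap f' g' := by
  apply Hom.ext
  refine tensorFun_ext (h := tensorFun (f ≫ f') (g ≫ g'))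
    (k := (tensorFun f' g').comp (tensorFun f g)) ?_
  rw [circ_comp, circ_eq_of_gc (f := tensorFun (f ≫ f') (g ≫ g')) (tensor_gc _ _),
    circ_eq_of_gc (f := tensorFun f g) (tensor_gc _ _),
    circ_eq_of_gc (f := tensorFun f' g') (tensor_gc _ _)]
  funext R
  apply Subtype.ext
  ext ⟨p, q⟩
  constructor
  · rintro h ⟨p', q'⟩ ⟨_, rfl, hp, hq⟩ ⟨r, s⟩ ⟨_, rfl, hr, hs⟩
    exact h ⟨_, rfl, hr.trans (OrderHomClass.mono f'.toFun hp),
      hs.trans (OrderHomClass.mono g'.toFun hq)⟩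
  · rintro h ⟨r, s⟩ ⟨_, rfl, hr, hs⟩
    have hr' : r.1 ≤ f'.toFun (f.toFun p.1) := hr
    have hs' : s.1 ≤ g'.toFun (g.toFun q.1) := hs
    rcases map_eq_bot_or f p with hp | ⟨p', hp⟩
    · rw [hp, map_bot] at hr'
      exact absurd hr' (Atoms.not_le_bot _)
    rcases map_eq_bot_or g q with hq | ⟨q', hq⟩
    · rw [hq, map_bot] at hs'
      exact absurd hs' (Atoms.not_le_bot _)
    rw [hp] at hr'
    rw [hq] at hs'
    exact h (a := (p', q')) ⟨_, rfl, hp.ge, hq.ge⟩ ⟨_, rfl, hr', hs'⟩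

/-! ## The bifunctors -/

/-- The bifunctor `- ⊛ -`. -/
def tensorFunctor : CalSym.{u} × CalSym.{u} ⥤ CalSym.{u} where
  obj X := tensorObj X.1 X.2
  map f := tensorMap f.1 f.2
  map_id X := tensorMap_id X.1 X.2
  map_comp f g := tensorMap_comp f.1 g.1 f.2 g.2

/-- The object `L ⊸ M = (L ⊛ M^op)^op`. -/
abbrev homObj (L M : CalSym.{u}) : CalSym.{u} := (tensorObj L M.op).op

/-- The action `f ⊸ g = (f ⊛ g^op)^op` of the internal hom on morphisms. -/
def homMap {L L' M M' : CalSym.{u}} (f : L' ⟶ L) (g : M ⟶ M') : homObj L M ⟶ homObj L' M' :=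
  opMap (tensorMap f (opMap g))

theorem homMap_id (L M : CalSym.{u}) : homMap (𝟙 L) (𝟙 M) = 𝟙 (homObj L M) := by
  rw [homMap, opMap_id, tensorMap_id, opMap_id]

theorem homMap_comp {L L' L'' M M' M'' : CalSym.{u}} (f : L' ⟶ L) (f' : L'' ⟶ L')
    (g : M ⟶ M') (g' : M' ⟶ M'') :
    homMap (f' ≫ f) (g ≫ g') = homMap f g ≫ homMap f' g' := by
  rw [homMap, opMap_comp, tensorMap_comp, opMap_comp]; rfl

/-- The bifunctor `- ⊸ -`, contravariant in the first variable. -/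
def homFunctor : CalSym.{u}ᵒᵖ ⥤ CalSym.{u} ⥤ CalSym.{u} where
  obj L :=
    { obj := fun M => homObj L.unop M
      map := fun g => homMap (𝟙 L.unop) g
      map_id := fun M => homMap_id L.unop M
      map_comp := fun g g' => by rw [← homMap_comp, Category.comp_id] }
  map f :=
    { app := fun M => homMap f.unop (𝟙 M)
      naturality := fun M M' g => by
        rw [← homMap_comp, ← homMap_comp]; simp }
  map_id L := by
    ext M
    exact homMap_id L.unop M
  map_comp f f' := by
    ext M
    change homMap (f'.unop ≫ f.unop) (𝟙 M) = homMap f.unop (𝟙 M) ≫ homMap f'.unop (𝟙 M)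
    rw [← homMap_comp, Category.comp_id]

end CalSym

/-! The proof rests on a description of arrows by atoms. An arrow `L ⟶ M` is determined by its
values on atoms. Conversely, a map `φ` from the atoms of `L` to atoms or `0` of `M` extends to an
arrow as soon as, for every coatom `x` of `M`, the set `{p | φ p ≤ x}` lies in `ClCoatoms L`
(`Hom.ofAtoms`). The coatoms of `L ⊛ M` are the proper relations all of whose slices lie in
`ClCoatoms`. Hence an arrow out of `L ⊛ M` amounts to a function of pairs of atoms that is an arrow
in each variable separately (`lift`). The symmetry, associativity and unit arrows arise this way
from evident formulas on pure tensors. The atoms of a tensor product are the pure tensors of atoms,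
so the coherence axioms are checked there. For closedness, `k : L ⊛ M ⟶ N` is encoded by the ternary
relation `k (a ⊗ b) ≤ c`. For a fixed atom `p`, the arrow `b ↦ k (p ⊗ b)` has a dual `N^op ⟶ M^op`.
These duals assemble to `L ⊛ N^op ⟶ M^op`, whose own dual is the transpose `M ⟶ L ⊸ N`. The same
relation describes both arrows (`tens_le_transpose`), which yields the bijection and its naturality.
For the dualizing object, 2 has a single atom, so an element of `L ⊛ 2^op` is in effect a set of
atoms of `L`. The canonical arrow swaps the roles of an element and a functional
(`tens_le_toDoubleDual`). It reflects the order because the coatoms of `L` give enough functionals,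
and it reaches every atom because the coatoms of `L ⊸ 2` come from atoms of `L`. -/

/-- Join-preserving maps out of an atomistic lattice are determined by their values on atoms. -/
theorem sSupHom_ext_atoms {L M : Type*} [CompleteLattice L] [IsAtomistic L] [CompleteLattice M]
    {f g : sSupHom L M} (h : ∀ p, IsAtom p → f p = g p) : f = g := by
  refine sSupHom.ext fun a => ?_
  rw [← sSup_atoms_le_eq a, map_sSup, map_sSup]
  exact congrArg sSup (Set.image_congr fun p hp => h p hp.1)

/-! ### Arrows described by their values on atoms -/

namespace CalSym

theorem comp_apply {L M N : CalSym.{u}} (f : L ⟶ M) (g : M ⟶ N) (a : L) :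
    (f ≫ g).toFun a = g.toFun (f.toFun a) := rfl

theorem id_apply {L : CalSym.{u}} (a : L) : (𝟙 L : L ⟶ L).toFun a = a := rfl

theorem hom_ext {L M : CalSym.{u}} {f g : L ⟶ M} (h : ∀ p, IsAtom p → f.toFun p = g.toFun p) :
    f = g :=
  Hom.ext (sSupHom_ext_atoms h)

theorem le_iff_coatoms {L : CalSym.{u}} {a b : L} : a ≤ b ↔ ∀ x, IsCoatom x → b ≤ x → a ≤ x := by
  refine ⟨fun h x _ hx => h.trans hx, fun h => ?_⟩
  by_contra hn
  obtain ⟨x, hx, hbx, hax⟩ := exists_coatom_not_le hn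
  exact hax (h x hx hbx)

theorem preimage_mem {L M : CalSym.{u}} (f : L ⟶ M) {x : M} (hx : IsCoatom x ∨ x = ⊤) :
    {p : Atoms L | f.toFun p.1 ≤ x} ∈ ClCoatoms L := by
  convert circ_mem_ClCoatoms f hx using 1
  ext p
  exact f.map_le_iff p.1 x

section ofAtoms

variable {L M : CalSym.{u}} (φ : Atoms L → M)

/-- Test against a coatom `x` above `b`. The atoms sent below `x` are those under a single `y`, so
`y` bounds every `q` in the join, hence `p`. -/
theorem le_of_le_sSup (h : ∀ x : M, IsCoatom x → {p | φ p ≤ x} ∈ ClCoatoms L) {p : Atoms L} {b : M}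
    (hp : p.1 ≤ sSup {a | ∃ q : Atoms L, φ q ≤ b ∧ a = q.1}) : φ p ≤ b := by
  refine le_iff_coatoms.2 fun x hx hbx => ?_
  obtain ⟨y, -, e⟩ := h x hx
  have hpy : p ∈ atomsBelow y := hp.trans (sSup_le ?_)
  · rw [← e] at hpy; exact hpy
  · rintro _ ⟨q, hq, rfl⟩
    have : q ∈ {p | φ p ≤ x} := hq.trans hbx
    rw [e] at this
    exact this

/-- Having a right adjoint gives the extension of `φ` preservation of joins, and it identifies
`circ` of that extension. -/
theorem ofAtoms_gc (h : ∀ x : M, IsCoatom x → {p | φ p ≤ x} ∈ ClCoatoms L) :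
    GaloisConnection (fun a : L => sSup (φ '' atomsBelow a))
      (fun b => sSup {a | ∃ q : Atoms L, φ q ≤ b ∧ a = q.1}) := by
  intro a b
  rw [sSup_le_iff, Set.forall_mem_image]
  constructor
  · intro H
    refine le_iff_atom_le_imp.2 fun p hp hpa => le_sSup ⟨⟨p, hp⟩, H hpa, rfl⟩
  · intro H p hp
    exact le_of_le_sSup φ h (le_trans hp H)

variable (h : ∀ x : M, IsCoatom x → {p | φ p ≤ x} ∈ ClCoatoms L)

/-- The morphism with prescribed values on the atoms. -/
def Hom.ofAtoms (hφ : ∀ p, IsAtom (φ p) ∨ φ p = ⊥) : L ⟶ M where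
  toFun :=
    { toFun := fun a => sSup (φ '' atomsBelow a)
      map_sSup' := fun _ => (ofAtoms_gc φ h).l_sSup.trans sSup_image.symm }
  atom p hp := by
    have : sSup (φ '' atomsBelow p) = φ ⟨p, hp⟩ := by
      rw [show atomsBelow p = {⟨p, hp⟩} from Set.ext fun q => Atoms.le_iff (q := ⟨p, hp⟩)]
      simp
    change IsAtom (sSup (φ '' atomsBelow p)) ∨ sSup (φ '' atomsBelow p) = ⊥
    rw [this]
    exact hφ _
  coatom x hx := by
    obtain ⟨y, hy, e⟩ := h x hx
    have hc := circ_eq_of_gc (ofAtoms_gc φ h)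
    -- The atoms sent below `x` are exactly those under `y`, and `y` is the join of its atoms.
    have : circ (fun a : L => sSup (φ '' atomsBelow a)) x = y := by
      rw [hc, ← sSup_atoms_le_eq y]
      refine congrArg sSup (Set.ext fun a => ?_)
      constructor
      · rintro ⟨q, hq, rfl⟩
        refine ⟨q.2, ?_⟩
        change q ∈ {p | φ p ≤ x} at hq
        rw [e] at hq; exact hq
      · rintro ⟨ha, hay⟩
        refine ⟨⟨a, ha⟩, ?_, rfl⟩
        change (⟨a, ha⟩ : Atoms L) ∈ {p | φ p ≤ x}
        rw [e]; exact hay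
    change IsCoatom (circ (fun a : L => sSup (φ '' atomsBelow a)) x) ∨
      circ (fun a : L => sSup (φ '' atomsBelow a)) x = ⊤
    rw [this]; exact hy

theorem Hom.ofAtoms_apply (hφ : ∀ p, IsAtom (φ p) ∨ φ p = ⊥) (p : Atoms L) :
    (Hom.ofAtoms φ h hφ).toFun p.1 = φ p := by
  change sSup (φ '' atomsBelow p.1) = φ p
  rw [show atomsBelow p.1 = {p} from Set.ext fun q => Atoms.le_iff]
  simp

end ofAtoms

/-! ## Pure tensors -/

section tens

variable {L M N : CalSym.{u}}

/-- The pure tensor of two elements, the join of the atoms `(p, q)` with `p ≤ a` and `q ≤ b`. -/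
def tens (a : L) (b : M) : tensorObj L M :=
  TensorLat.closure {r : Atoms L × Atoms M | r.1.1 ≤ a ∧ r.2.1 ≤ b}

theorem tens_le {a : L} {b : M} {R : tensorObj L M} :
    tens a b ≤ R ↔ ∀ (p : Atoms L) (q : Atoms M), p.1 ≤ a → q.1 ≤ b → (p, q) ∈ R.1 :=
  TensorLat.closure_le.trans ⟨fun h _ _ hp hq => h ⟨hp, hq⟩, fun h r hr => h r.1 r.2 hr.1 hr.2⟩

theorem tens_atoms (p : Atoms L) (q : Atoms M) :
    tens p.1 q.1 = TensorLat.closure {(p, q)} := by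
  refine congrArg TensorLat.closure (Set.ext fun r => ?_)
  change r.1.1 ≤ p.1 ∧ r.2.1 ≤ q.1 ↔ r = (p, q)
  rw [Atoms.le_iff, Atoms.le_iff, Prod.ext_iff]

theorem tens_atoms_le {p : Atoms L} {q : Atoms M} {R : tensorObj L M} :
    tens p.1 q.1 ≤ R ↔ (p, q) ∈ R.1 := by
  rw [tens_atoms]
  exact TensorLat.closure_le.trans Set.singleton_subset_iff

theorem isAtom_tens {p : L} {q : M} (hp : IsAtom p) (hq : IsAtom q) : IsAtom (tens p q) := by
  rw [tens_atoms ⟨p, hp⟩ ⟨q, hq⟩]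
  exact TensorLat.isAtom_closure_singleton _

theorem exists_tens_of_isAtom {P : tensorObj L M} (hP : IsAtom P) :
    ∃ (p : Atoms L) (q : Atoms M), P = tens p.1 q.1 := by
  obtain ⟨⟨p, q⟩, h⟩ := TensorLat.eq_closure_of_isAtom hP
  exact ⟨p, q, h.trans (tens_atoms p q).symm⟩

theorem tensor_hom_ext {f g : tensorObj L M ⟶ N}
    (h : ∀ (p : Atoms L) (q : Atoms M), f.toFun (tens p.1 q.1) = g.toFun (tens p.1 q.1)) :
    f = g := by
  refine hom_ext fun P hP => ?_
  obtain ⟨p, q, rfl⟩ := exists_tens_of_isAtom hP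
  exact h p q

theorem tensor_le {R S : tensorObj L M} (h : ∀ (p : Atoms L) (q : Atoms M),
    tens p.1 q.1 ≤ R → tens p.1 q.1 ≤ S) : R ≤ S := by
  rintro ⟨p, q⟩ hr
  exact tens_atoms_le.1 (h p q (tens_atoms_le.2 hr))

theorem tensor_ext {R S : tensorObj L M} (h : ∀ (p : Atoms L) (q : Atoms M),
    tens p.1 q.1 ≤ R ↔ tens p.1 q.1 ≤ S) : R = S :=
  le_antisymm (tensor_le fun p q => (h p q).1) (tensor_le fun p q => (h p q).2)

theorem slice₁_mem {R : tensorObj L M} (hR : IsCoatom R) (q : Atoms M) :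
    {p : Atoms L | tens p.1 q.1 ≤ R} ∈ ClCoatoms L := by
  simp only [tens_atoms_le]
  exact (TensorLat.coatom_mem hR).2.1 q

theorem slice₂_mem {R : tensorObj L M} (hR : IsCoatom R) (p : Atoms L) :
    {q : Atoms M | tens p.1 q.1 ≤ R} ∈ ClCoatoms M := by
  simp only [tens_atoms_le]
  exact (TensorLat.coatom_mem hR).2.2 p

/-- Converse of the two slice lemmas: together they reduce the coatom condition on an arrow out of a
tensor product to one condition per variable. -/
theorem mem_ClCoatoms_tensor {S : Set (Atoms (tensorObj L M))}
    (h₁ : ∀ q : Atoms M, {p : Atoms L | ⟨_, isAtom_tens p.2 q.2⟩ ∈ S} ∈ ClCoatoms L)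
    (h₂ : ∀ p : Atoms L, {q : Atoms M | ⟨_, isAtom_tens p.2 q.2⟩ ∈ S} ∈ ClCoatoms M) :
    S ∈ ClCoatoms (tensorObj L M) := by
  have hR : {r : Atoms L × Atoms M | (⟨_, isAtom_tens r.1.2 r.2.2⟩ : Atoms (tensorObj L M)) ∈ S} ∈
      tensorCoatoms L M ∪ {Set.univ} := mem_coatoms_union.2 ⟨h₁, h₂⟩
  refine ⟨TensorLat.ofCoatom _ hR, ?_, ?_⟩
  · rcases hR with hR | hR
    · exact Or.inl (TensorLat.isCoatom_ofCoatom M.a0 hR)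
    · exact Or.inr (Subtype.ext (Eq.trans hR TensorLat.coe_top.symm))
  · ext ⟨P, hP⟩
    obtain ⟨p, q, rfl⟩ := exists_tens_of_isAtom hP
    exact (tens_atoms_le (R := TensorLat.ofCoatom _ hR)).symm

/-- It suffices to work inside each coatom `S` above `R`. There the slice at `q` consists of the
atoms under one `y`, which bounds every `a` with `a ⊗ b ≤ R`, hence their join. -/
theorem tens_gc_left (b : M) : GaloisConnection (fun a : L => tens a b)
    (fun R => sSup {a | tens a b ≤ R}) := by
  have mono : ∀ a a' : L, a ≤ a' → ∀ b : M, tens a b ≤ tens a' b := fun a a' h b =>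
    tens_le.2 fun p q hp hq => tens_le.1 le_rfl p q (hp.trans h) hq
  refine fun a R => ⟨fun h => le_sSup h, fun h => (mono _ _ h b).trans ?_⟩
  refine tens_le.2 fun p q hp hq => R.mem_of_forall _ fun S hS hRS => ?_
  obtain ⟨y, -, e⟩ := hS.2.1 q
  have : p ∈ atomsBelow y := hp.trans (sSup_le fun a ha => ?_)
  · rw [← e] at this; exact this
  · rw [← atomsBelow_subset, ← e]
    exact fun r hr => hRS (tens_le.1 ha r q hr hq)

theorem tens_gc_right (a : L) : GaloisConnection (fun b : M => tens a b)
    (fun R => sSup {b | tens a b ≤ R}) := by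
  have mono : ∀ b b' : M, b ≤ b' → tens a b ≤ tens a b' := fun b b' h =>
    tens_le.2 fun p q hp hq => tens_le.1 le_rfl p q hp (hq.trans h)
  refine fun b R => ⟨fun h => le_sSup h, fun h => (mono _ _ h).trans ?_⟩
  refine tens_le.2 fun p q hp hq => R.mem_of_forall _ fun S hS hRS => ?_
  obtain ⟨y, -, e⟩ := hS.2.2 p
  have : q ∈ atomsBelow y := hq.trans (sSup_le fun b hb => ?_)
  · rw [← e] at this; exact this
  · rw [← atomsBelow_subset, ← e]
    exact fun r hr => hRS (tens_le.1 hb p r hp hr)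

/-- `a ↦ a ⊗ b` as a join-preserving map. -/
def tensLeft (b : M) : sSupHom L (tensorObj L M) where
  toFun a := tens a b
  map_sSup' _ := (tens_gc_left b).l_sSup.trans sSup_image.symm

/-- `b ↦ a ⊗ b` as a join-preserving map. -/
def tensRight (a : L) : sSupHom M (tensorObj L M) where
  toFun b := tens a b
  map_sSup' _ := (tens_gc_right a).l_sSup.trans sSup_image.symm

theorem bot_tens (b : M) : tens (⊥ : L) b = ⊥ := (tens_gc_left b).l_bot

/-- `a ↦ a ⊗ q` as a morphism, for an atom `q`. -/
def tensL (L : CalSym.{u}) (q : Atoms M) : L ⟶ tensorObj L M :=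
  Hom.ofAtoms (fun p => tens p.1 q.1) (fun _ hx => slice₁_mem hx q)
    (fun p => Or.inl (isAtom_tens p.2 q.2))

theorem tensL_apply (q : Atoms M) (a : L) : (tensL L q).toFun a = tens a q.1 :=
  DFunLike.congr_fun (sSupHom_ext_atoms (f := (tensL L q).toFun) (g := tensLeft q.1)
    fun p hp => Hom.ofAtoms_apply _ _ _ ⟨p, hp⟩) a

/-- `b ↦ p ⊗ b` as a morphism, for an atom `p`. -/
def tensR (M : CalSym.{u}) (p : Atoms L) : M ⟶ tensorObj L M :=
  Hom.ofAtoms (fun q => tens p.1 q.1) (fun _ hx => slice₂_mem hx p)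
    (fun q => Or.inl (isAtom_tens p.2 q.2))

theorem tensR_apply (p : Atoms L) (b : M) : (tensR M p).toFun b = tens p.1 b :=
  DFunLike.congr_fun (sSupHom_ext_atoms (f := (tensR M p).toFun) (g := tensRight p.1)
    fun q hq => Hom.ofAtoms_apply _ _ _ ⟨q, hq⟩) b

/-- The left component of an atom of a tensor product. -/
noncomputable def Atoms.fst (P : Atoms (tensorObj L M)) : Atoms L :=
  (exists_tens_of_isAtom P.2).choose

/-- The right component of an atom of a tensor product. -/
noncomputable def Atoms.snd (P : Atoms (tensorObj L M)) : Atoms M :=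
  (exists_tens_of_isAtom P.2).choose_spec.choose

theorem Atoms.tens_fst_snd (P : Atoms (tensorObj L M)) :
    tens (Atoms.fst P).1 (Atoms.snd P).1 = P.1 :=
  (exists_tens_of_isAtom P.2).choose_spec.choose_spec.symm

theorem tens_atoms_inj {p p' : Atoms L} {q q' : Atoms M} (h : tens p.1 q.1 = tens p'.1 q'.1) :
    p = p' ∧ q = q' := by
  have : (p, q) ∈ (tens p'.1 q'.1 : tensorObj L M).1 := tens_atoms_le.1 h.le
  rw [tens_atoms, TensorLat.coe_closure_singleton] at this
  exact Prod.ext_iff.1 this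

theorem Atoms.fst_tens (p : Atoms L) (q : Atoms M) :
    Atoms.fst ⟨tens p.1 q.1, isAtom_tens p.2 q.2⟩ = p :=
  (tens_atoms_inj (Atoms.tens_fst_snd ⟨tens p.1 q.1, isAtom_tens p.2 q.2⟩)).1

theorem Atoms.snd_tens (p : Atoms L) (q : Atoms M) :
    Atoms.snd ⟨tens p.1 q.1, isAtom_tens p.2 q.2⟩ = q :=
  (tens_atoms_inj (Atoms.tens_fst_snd ⟨tens p.1 q.1, isAtom_tens p.2 q.2⟩)).2

/-- The morphism out of a tensor product determined by a family of morphisms out of the second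
factor, indexed by the atoms of the first. -/
noncomputable def lift (G : Atoms L → (M ⟶ N))
    (h : ∀ (q : Atoms M) (x : N), IsCoatom x → {p | (G p).toFun q.1 ≤ x} ∈ ClCoatoms L) :
    tensorObj L M ⟶ N :=
  Hom.ofAtoms (fun P => (G (Atoms.fst P)).toFun (Atoms.snd P).1)
    (fun x hx => mem_ClCoatoms_tensor
      (fun q => by
        simp only [Set.mem_ofPred_eq, Atoms.fst_tens, Atoms.snd_tens]
        exact h q x hx)
      (fun p => by
        simp only [Set.mem_ofPred_eq, Atoms.fst_tens, Atoms.snd_tens]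
        exact preimage_mem (G p) (Or.inl hx)))
    (fun P => (G _).atom _ (Atoms.snd P).2)

theorem lift_apply_atom (G : Atoms L → (M ⟶ N))
    (h : ∀ (q : Atoms M) (x : N), IsCoatom x → {p | (G p).toFun q.1 ≤ x} ∈ ClCoatoms L)
    (P : Atoms (tensorObj L M)) :
    (lift G h).toFun P.1 = (G (Atoms.fst P)).toFun (Atoms.snd P).1 := by
  unfold lift
  exact Hom.ofAtoms_apply _ _ _ P

/-- Both sides preserve joins in `b`, so the defining formula on atoms extends to all `b`. -/
theorem lift_tens_atom (G : Atoms L → (M ⟶ N))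
    (h : ∀ (q : Atoms M) (x : N), IsCoatom x → {p | (G p).toFun q.1 ≤ x} ∈ ClCoatoms L)
    (p : Atoms L) (b : M) : (lift G h).toFun (tens p.1 b) = (G p).toFun b := by
  refine DFunLike.congr_fun (sSupHom_ext_atoms (f := (lift G h).toFun.comp (tensRight p.1))
    (g := (G p).toFun) fun q hq => ?_) b
  refine (lift_apply_atom G h ⟨tens p.1 q, isAtom_tens p.2 hq⟩).trans ?_
  rw [Atoms.fst_tens p ⟨q, hq⟩, Atoms.snd_tens p ⟨q, hq⟩]

/-- Since `a ↦ f (a ⊗ b)` preserves joins, formulas known for an atom in the first variable pass to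
arbitrary elements. -/
theorem bilinear_ext {f : tensorObj L M ⟶ N} (b : M) (g : sSupHom L N)
    (h : ∀ p : Atoms L, f.toFun (tens p.1 b) = g p.1) (a : L) : f.toFun (tens a b) = g a :=
  DFunLike.congr_fun (sSupHom_ext_atoms (f := f.toFun.comp (tensLeft b)) (g := g)
    fun p hp => h ⟨p, hp⟩) a

/-- On atoms, `imageSet` of `{(p, q)}` is the very set generating `f p ⊗ g q`, so vanishing values
need no separate case. -/
theorem tensorMap_tens {L' M' : CalSym.{u}} (f : L ⟶ L') (g : M ⟶ M') (a : L) (b : M) :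
    (tensorMap f g).toFun (tens a b) = tens (f.toFun a) (g.toFun b) := by
  refine bilinear_ext (f := tensorMap f g) b ((tensLeft (g.toFun b)).comp f.toFun) (fun p => ?_) a
  refine DFunLike.congr_fun (sSupHom_ext_atoms (f := (tensorMap f g).toFun.comp (tensRight p.1))
    (g := (tensRight (f.toFun p.1)).comp g.toFun) fun q hq => ?_) b
  change (tensorMap f g).toFun (tens p.1 (⟨q, hq⟩ : Atoms M).1) = tens (f.toFun p.1) (g.toFun q)
  rw [tens_atoms]
  change TensorLat.closure (imageSet f g (TensorLat.closure {(p, ⟨q, hq⟩)}).1) =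
    TensorLat.closure _
  rw [TensorLat.coe_closure_singleton]
  congr 1
  ext r
  constructor
  · rintro ⟨_, rfl, h⟩; exact h
  · intro h; exact ⟨_, rfl, h⟩

end tens

/-! ## Structure isomorphisms -/

section structure_isos

variable (L M N : CalSym.{u})

/-- The symmetry `L ⊛ M ⟶ M ⊛ L`. -/
noncomputable def braid : tensorObj L M ⟶ tensorObj M L :=
  lift (fun p => tensL M p) fun q x hx => by
    simp only [tensL_apply]
    exact slice₂_mem hx q

variable {L M N} in
@[simp]
theorem braid_tens (a : L) (b : M) : (braid L M).toFun (tens a b) = tens b a :=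
  bilinear_ext b (tensRight b) (fun p => (lift_tens_atom _ _ p b).trans (tensL_apply p b)) a

/-- The morphism `L ⊛ (M ⊛ N) ⟶ (L ⊛ M) ⊛ N`. -/
noncomputable def assocInv : tensorObj L (tensorObj M N) ⟶ tensorObj (tensorObj L M) N :=
  lift (fun p => tensorMap (tensR M p) (𝟙 N)) fun Q x hx => by
    -- For `Q = q ⊗ r` the map `p ↦ (p ⊗ q) ⊗ r` is a composite of two arrows, so the preimage of a
    -- coatom has the required form.
    obtain ⟨q, r, hQ⟩ := exists_tens_of_isAtom Q.2
    have := preimage_mem (tensL L q ≫ tensL (tensorObj L M) r) (Or.inl hx)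
    simp only [comp_apply, tensL_apply] at this
    simpa only [hQ, tensorMap_tens, tensR_apply, id_apply] using this

variable {L M N} in
@[simp]
theorem assocInv_tens (a : L) (b : M) (c : N) :
    (assocInv L M N).toFun (tens a (tens b c)) = tens (tens a b) c := by
  refine bilinear_ext (tens b c) ((tensLeft c).comp (tensLeft b)) (fun p => ?_) a
  refine (lift_tens_atom _ _ p (tens b c)).trans ?_
  rw [tensorMap_tens, tensR_apply]
  rfl

/-- The morphism `(L ⊛ M) ⊛ N ⟶ L ⊛ (M ⊛ N)`. -/
noncomputable def assocHom : tensorObj (tensorObj L M) N ⟶ tensorObj L (tensorObj M N) :=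
  -- Symmetries turn `(L ⊛ M) ⊛ N` into `N ⊛ (M ⊛ L)`; after `assocInv`, they turn `(N ⊛ M) ⊛ L`
  -- into `L ⊛ (M ⊛ N)`.
  braid _ _ ≫ tensorMap (𝟙 N) (braid L M) ≫ assocInv N M L ≫ braid _ _ ≫
    tensorMap (𝟙 L) (braid N M)

variable {L M N} in
@[simp]
theorem assocHom_tens (a : L) (b : M) (c : N) :
    (assocHom L M N).toFun (tens (tens a b) c) = tens a (tens b c) := by
  simp only [assocHom, comp_apply, braid_tens, tensorMap_tens, assocInv_tens, id_apply]

/-- There is only one atom, so `S` is empty (under the coatom `⊥`) or everything. Slice conditions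
in a two-element factor are therefore vacuous. -/
theorem mem_ClCoatoms_of_isSimpleOrder {T : Type u} [CompleteLattice T] [IsSimpleOrder T]
    (S : Set (Atoms T)) : S ∈ ClCoatoms T := by
  by_cases h : ∃ t, t ∈ S
  · obtain ⟨t, ht⟩ := h
    convert univ_mem_ClCoatoms
    refine Set.eq_univ_of_forall fun s => ?_
    rwa [show s = t from
      Subtype.ext ((isAtom_iff_eq_top.1 s.2).trans (isAtom_iff_eq_top.1 t.2).symm)]
  · refine ⟨⊥, Or.inl isCoatom_bot, ?_⟩
    ext t
    exact ⟨fun ht => (h ⟨t, ht⟩).elim, fun ht => (t.2.1 (le_bot_iff.1 ht)).elim⟩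

/-- The atom of the two-element lattice. -/
noncomputable def twoAtom : Atoms two.{u} := ⟨⊤, isAtom_top (α := ULift.{u} Bool)⟩

theorem eq_twoAtom (t : Atoms two.{u}) : t = twoAtom :=
  Subtype.ext ((IsSimpleOrder.eq_bot_or_eq_top (α := ULift.{u} Bool) t.1).resolve_left t.2.1)

/-- The left unit morphism. -/
noncomputable def unitL : tensorObj two L ⟶ L :=
  lift (fun _ => 𝟙 L) fun _ _ _ => mem_ClCoatoms_of_isSimpleOrder (T := ULift.{u} Bool) _

variable {L} in
@[simp]
theorem unitL_tens (a : L) : (unitL L).toFun (tens twoAtom.1 a) = a :=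
  lift_tens_atom _ _ twoAtom a

/-- The right unit morphism. -/
noncomputable def unitR : tensorObj L two ⟶ L := braid L two ≫ unitL L

variable {L} in
@[simp]
theorem unitR_tens (a : L) : (unitR L).toFun (tens a twoAtom.1) = a := by
  simp only [unitR, comp_apply, braid_tens, unitL_tens]

end structure_isos

/-! ## The symmetric monoidal structure -/

section monoidal

variable {K L M N P : CalSym.{u}}

theorem tensor_hom_ext₃ {f g : tensorObj (tensorObj K L) M ⟶ P}
    (h : ∀ (p : Atoms K) (q : Atoms L) (r : Atoms M), f.toFun (tens (tens p.1 q.1) r.1) =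
      g.toFun (tens (tens p.1 q.1) r.1)) : f = g := by
  refine tensor_hom_ext fun S r => ?_
  obtain ⟨p, q, e⟩ := exists_tens_of_isAtom S.2
  rw [e]
  exact h p q r

theorem tensor_hom_ext_right {f g : tensorObj K (tensorObj L M) ⟶ P}
    (h : ∀ (p : Atoms K) (q : Atoms L) (r : Atoms M), f.toFun (tens p.1 (tens q.1 r.1)) =
      g.toFun (tens p.1 (tens q.1 r.1))) : f = g := by
  refine tensor_hom_ext fun p S => ?_
  obtain ⟨q, r, e⟩ := exists_tens_of_isAtom S.2
  rw [e]
  exact h p q r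

theorem tensor_hom_ext₄ {f g : tensorObj (tensorObj (tensorObj K L) M) N ⟶ P}
    (h : ∀ (p : Atoms K) (q : Atoms L) (r : Atoms M) (s : Atoms N),
      f.toFun (tens (tens (tens p.1 q.1) r.1) s.1) =
        g.toFun (tens (tens (tens p.1 q.1) r.1) s.1)) : f = g := by
  refine tensor_hom_ext₃ fun S r s => ?_
  obtain ⟨p, q, e⟩ := exists_tens_of_isAtom S.2
  rw [e]
  exact h p q r s

/-- The symmetry isomorphism. -/
noncomputable def braidIso (L M : CalSym.{u}) : tensorObj L M ≅ tensorObj M L where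
  hom := braid L M
  inv := braid M L
  hom_inv_id := tensor_hom_ext fun p q => by simp only [comp_apply, id_apply, braid_tens]
  inv_hom_id := tensor_hom_ext fun p q => by simp only [comp_apply, id_apply, braid_tens]

/-- The associativity isomorphism. -/
noncomputable def assocIso (L M N : CalSym.{u}) :
    tensorObj (tensorObj L M) N ≅ tensorObj L (tensorObj M N) where
  hom := assocHom L M N
  inv := assocInv L M N
  hom_inv_id := tensor_hom_ext₃ fun p q r => by
    simp only [comp_apply, id_apply, assocHom_tens, assocInv_tens]
  inv_hom_id := tensor_hom_ext_right fun p q r => by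
    simp only [comp_apply, id_apply, assocHom_tens, assocInv_tens]

/-- The left unit isomorphism. -/
noncomputable def unitLIso (L : CalSym.{u}) : tensorObj two L ≅ L where
  hom := unitL L
  inv := tensR L twoAtom
  hom_inv_id := tensor_hom_ext fun t q => by
    rw [eq_twoAtom t]
    simp only [comp_apply, id_apply, unitL_tens, tensR_apply]
  inv_hom_id := hom_ext fun p _ => by
    simp only [comp_apply, id_apply, unitL_tens, tensR_apply]

/-- The right unit isomorphism. -/
noncomputable def unitRIso (L : CalSym.{u}) : tensorObj L two ≅ L := braidIso L two ≪≫ unitLIso L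

noncomputable instance : MonoidalCategoryStruct CalSym.{u} where
  tensorObj := tensorObj
  whiskerLeft X _ _ f := tensorMap (𝟙 X) f
  whiskerRight f Y := tensorMap f (𝟙 Y)
  tensorHom := tensorMap
  tensorUnit := two
  associator := assocIso
  leftUnitor := unitLIso
  rightUnitor := unitRIso

noncomputable instance : MonoidalCategory CalSym.{u} :=
  MonoidalCategory.ofTensorHom
    (id_tensorHom := fun _ _ _ _ => rfl)
    (tensorHom_id := fun _ _ => rfl)
    (id_tensorHom_id := tensorMap_id)
    (tensorHom_comp_tensorHom := fun f g h k => (tensorMap_comp f h g k).symm)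
    (associator_naturality := fun {X₁ X₂ X₃ Y₁ Y₂ Y₃} f g h => tensor_hom_ext₃ fun p q r => by
      change (tensorMap (tensorMap f g) h ≫ assocHom Y₁ Y₂ Y₃).toFun _ =
        (assocHom X₁ X₂ X₃ ≫ tensorMap f (tensorMap g h)).toFun _
      simp only [comp_apply, tensorMap_tens, assocHom_tens])
    (leftUnitor_naturality := fun {X Y} f => tensor_hom_ext fun t q => by
      change (tensorMap (𝟙 two) f ≫ unitL Y).toFun _ = (unitL X ≫ f).toFun _
      rw [eq_twoAtom t]
      simp only [comp_apply, tensorMap_tens, unitL_tens, id_apply])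
    (rightUnitor_naturality := fun {X Y} f => tensor_hom_ext fun p t => by
      change (tensorMap f (𝟙 two) ≫ unitR Y).toFun _ = (unitR X ≫ f).toFun _
      rw [eq_twoAtom t]
      simp only [comp_apply, tensorMap_tens, unitR_tens, id_apply])
    (pentagon := fun W X Y Z => tensor_hom_ext₄ fun p q r s => by
      change (tensorMap (assocHom W X Y) (𝟙 Z) ≫ assocHom W _ Z ≫
          tensorMap (𝟙 W) (assocHom X Y Z)).toFun _ =
        (assocHom (tensorObj W X) Y Z ≫ assocHom W X (tensorObj Y Z)).toFun _
      simp only [comp_apply, tensorMap_tens, assocHom_tens, id_apply])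
    (triangle := fun X Y => tensor_hom_ext₃ fun p t q => by
      change (assocHom X two Y ≫ tensorMap (𝟙 X) (unitL Y)).toFun _ =
        (tensorMap (unitR X) (𝟙 Y)).toFun _
      rw [eq_twoAtom t]
      simp only [comp_apply, tensorMap_tens, unitL_tens, unitR_tens, assocHom_tens, id_apply])

noncomputable instance : SymmetricCategory CalSym.{u} where
  braiding := braidIso
  braiding_naturality_right X Y Z f := tensor_hom_ext fun p q => by
    change (tensorMap (𝟙 X) f ≫ braid X Z).toFun _ = (braid X Y ≫ tensorMap f (𝟙 X)).toFun _
    simp only [comp_apply, tensorMap_tens, braid_tens, id_apply]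
  braiding_naturality_left {X Y} f Z := tensor_hom_ext fun p q => by
    change (tensorMap f (𝟙 Z) ≫ braid Y Z).toFun _ = (braid X Z ≫ tensorMap (𝟙 Z) f).toFun _
    simp only [comp_apply, tensorMap_tens, braid_tens, id_apply]
  hexagon_forward X Y Z := tensor_hom_ext₃ fun p q r => by
    change (assocHom X Y Z ≫ braid _ _ ≫ assocHom Y Z X).toFun _ =
      (tensorMap (braid X Y) (𝟙 Z) ≫ assocHom Y X Z ≫ tensorMap (𝟙 Y) (braid X Z)).toFun _
    simp only [comp_apply, tensorMap_tens, braid_tens, id_apply, assocHom_tens]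
  hexagon_reverse X Y Z := tensor_hom_ext_right fun p q r => by
    change (assocInv X Y Z ≫ braid _ _ ≫ assocInv Z X Y).toFun _ =
      (tensorMap (𝟙 X) (braid Y Z) ≫ assocInv X Z Y ≫ tensorMap (braid X Z) (𝟙 Y)).toFun _
    simp only [comp_apply, tensorMap_tens, braid_tens, id_apply, assocInv_tens]
  symmetry X Y := (braidIso X Y).hom_inv_id

end monoidal

end CalSym

theorem sSupHom_le_iff_atoms {L M : Type*} [CompleteLattice L] [IsAtomistic L] [CompleteLattice M]
    (f : sSupHom L M) {a : L} {b : M} : f a ≤ b ↔ ∀ p, IsAtom p → p ≤ a → f p ≤ b := by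
  refine ⟨fun h p _ hp => (OrderHomClass.mono f hp).trans h, fun h => ?_⟩
  rw [← sSup_atoms_le_eq a, map_sSup, sSup_le_iff]
  rintro _ ⟨p, ⟨hp, hpa⟩, rfl⟩
  exact h p hp hpa

/-! ### Passing to the dual lattice -/

namespace CalSym

/-- An element of `L` as an element of the dual lattice. -/
def toOp (L : CalSym.{u}) (a : L) : L.op := OrderDual.toDual (α := L.carrier) a

/-- An element of the dual lattice as an element of `L`. -/
def ofOp (L : CalSym.{u}) (a : L.op) : L := OrderDual.ofDual (α := L.carrier) a

theorem isAtom_toOp {L : CalSym.{u}} {x : L} (hx : IsCoatom x) : IsAtom (toOp L x) := hx.dual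

theorem isCoatom_ofOp {L : CalSym.{u}} {x : L.op} (hx : IsAtom x) : IsCoatom (ofOp L x) := hx

theorem isAtom_ofOp {L : CalSym.{u}} {x : L.op} (hx : IsCoatom x) : IsAtom (ofOp L x) := hx

/-! ## The closed structure -/

section closed

variable {L L' M M' N : CalSym.{u}}

/-- The adjunction between `f` and `f°`, read in the reversed orders. -/
theorem opMap_le (f : L ⟶ M) (y : M.op) (a : L.op) :
    (opMap f).toFun y ≤ a ↔ f.toFun (ofOp L a) ≤ ofOp M y :=
  (f.map_le_iff (ofOp L a) (ofOp M y)).symm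

/-- The dual of a morphism into a dual lattice. -/
def opMapRight (f : L ⟶ M.op) : M ⟶ L.op := opMap f

theorem le_opMapRight (f : L ⟶ M.op) (b : M) (a : L) :
    a ≤ ofOp L ((opMapRight f).toFun b) ↔ f.toFun a ≤ toOp M b :=
  opMap_le f b a

/-- The dual of a morphism out of a dual lattice. -/
def opMapLeft (f : L.op ⟶ M) : M.op ⟶ L := opMap f

theorem opMapLeft_le (f : L.op ⟶ M) (b : M.op) (a : L) :
    (opMapLeft f).toFun b ≤ a ↔ f.toFun (toOp L a) ≤ ofOp M b :=
  opMap_le f b a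

/-- The evaluation morphism `L ⊛ (L ⊸ N) ⟶ N`. -/
noncomputable def eval (L N : CalSym.{u}) : tensorObj L (homObj L N) ⟶ N :=
  lift (fun p => opMapLeft (tensR N.op p)) fun Z x hx => by
    -- By adjunction the condition on `p` becomes `p ⊗ x ≤ Z`, a slice of `Z`, which is a coatom of
    -- `L ⊛ N^op`.
    convert slice₁_mem (isCoatom_ofOp Z.2) ⟨toOp N x, isAtom_toOp hx⟩ using 1
    ext p
    refine (opMapLeft_le _ _ _).trans ?_
    rw [tensR_apply]
    rfl

/-- With `Z` viewed as a relation between `L` and `N^op`, evaluation at `a` is the least `c` with `a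
⊗ c ≤ Z`. -/
theorem eval_tens_le (a : L) (Z : homObj L N) (c : N) :
    (eval L N).toFun (tens a Z) ≤ c ↔ tens a (toOp N c) ≤ ofOp (tensorObj L N.op) Z := by
  refine (sSupHom_le_iff_atoms ((eval L N).toFun.comp (tensLeft Z))).trans
    (Iff.trans (forall₃_congr fun p hp _ => ?_)
      (sSupHom_le_iff_atoms (tensLeft (toOp N c))).symm)
  change (eval L N).toFun (tens (⟨p, hp⟩ : Atoms L).1 Z) ≤ c ↔ _
  unfold eval
  rw [lift_tens_atom, opMapLeft_le, tensR_apply]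
  rfl

/-- The morphism `L ⊛ N^op ⟶ M^op` whose dual is the transpose of `k : L ⊛ M ⟶ N`. -/
noncomputable def coTranspose (k : tensorObj L M ⟶ N) : tensorObj L N.op ⟶ M.op :=
  lift (fun p => opMap (tensR M p ≫ k)) fun x q hq => by
    -- Here `q` is an atom of `M` and `x` a coatom of `N`; by adjunction the set is `{p | k (p ⊗ q)
    -- ≤ x}`.
    convert preimage_mem (tensL L ⟨ofOp M q, isAtom_ofOp hq⟩ ≫ k) (Or.inl (isCoatom_ofOp x.2))
      using 1
    ext p
    refine (opMap_le _ _ _).trans ?_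
    change _ ↔ (tensL L ⟨ofOp M q, isAtom_ofOp hq⟩ ≫ k).toFun p.1 ≤ _
    rw [comp_apply, comp_apply, tensR_apply, tensL_apply]

theorem coTranspose_tens_le (k : tensorObj L M ⟶ N) (a : L) (b : M) (c : N) :
    (coTranspose k).toFun (tens a (toOp N c)) ≤ toOp M b ↔ k.toFun (tens a b) ≤ c := by
  refine (sSupHom_le_iff_atoms ((coTranspose k).toFun.comp (tensLeft (toOp N c)))).trans
    (Iff.trans (forall₃_congr fun p hp _ => ?_)
      (sSupHom_le_iff_atoms (k.toFun.comp (tensLeft b))).symm)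
  change (coTranspose k).toFun (tens (⟨p, hp⟩ : Atoms L).1 (toOp N c)) ≤ _ ↔
    k.toFun (tens p b) ≤ c
  unfold coTranspose
  rw [lift_tens_atom, opMap_le, comp_apply, tensR_apply]
  rfl

/-- The transpose `M ⟶ L ⊸ N` of `k : L ⊛ M ⟶ N`. -/
noncomputable def transpose (k : tensorObj L M ⟶ N) : M ⟶ homObj L N := opMapRight (coTranspose k)

/-- This equivalence characterizes the transpose; with `eval_tens_le` it yields both inverse laws
and all naturality statements. -/
theorem tens_le_transpose (k : tensorObj L M ⟶ N) (a : L) (b : M) (c : N) :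
    tens a (toOp N c) ≤ ofOp (tensorObj L N.op) ((transpose k).toFun b) ↔ k.toFun (tens a b) ≤ c :=
  (le_opMapRight (coTranspose k) b _).trans (coTranspose_tens_le k a b c)

theorem homObj_ext {Z Z' : homObj L N}
    (h : ∀ (a : L) (c : N), tens a (toOp N c) ≤ ofOp (tensorObj L N.op) Z ↔
      tens a (toOp N c) ≤ ofOp (tensorObj L N.op) Z') : Z = Z' :=
  tensor_ext (L := L) (M := N.op) fun p q => h p.1 (ofOp N q.1)

theorem eq_of_forall_le {a b : L} (h : ∀ c, a ≤ c ↔ b ≤ c) : a = b :=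
  le_antisymm ((h b).2 le_rfl) ((h a).1 le_rfl)

theorem tensorMap_transpose_eval (k : tensorObj L M ⟶ N) :
    tensorMap (𝟙 L) (transpose k) ≫ eval L N = k :=
  tensor_hom_ext fun p q => eq_of_forall_le fun c => by
    rw [comp_apply, tensorMap_tens, id_apply, eval_tens_le, tens_le_transpose]

theorem transpose_tensorMap_eval (g : M ⟶ homObj L N) :
    transpose (tensorMap (𝟙 L) g ≫ eval L N) = g :=
  hom_ext fun b _ => homObj_ext fun a c => by
    rw [tens_le_transpose, comp_apply, tensorMap_tens, id_apply, eval_tens_le]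

/-- The bijection `Hom(L ⊛ M, N) ≃ Hom(M, L ⊸ N)`. -/
noncomputable def transposeEquiv (L M N : CalSym.{u}) :
    (tensorObj L M ⟶ N) ≃ (M ⟶ homObj L N) where
  toFun := transpose
  invFun g := tensorMap (𝟙 L) g ≫ eval L N
  left_inv := tensorMap_transpose_eval
  right_inv := transpose_tensorMap_eval

/-- The internal hom acts on relations by pulling back along `f` and `g^op`. -/
theorem tens_le_homMap (f : L' ⟶ L) (g : N ⟶ M) (Z : homObj L N) (a : L') (c : M.op) :
    tens a c ≤ ofOp (tensorObj L' M.op) ((homMap f g).toFun Z) ↔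
      tens (f.toFun a) ((opMap g).toFun c) ≤ ofOp (tensorObj L N.op) Z := by
  rw [← tensorMap_tens]
  exact opMap_le (tensorMap f (opMap g)) Z (toOp _ (tens a c))

/-! ### Naturality of transposition in each variable -/

theorem transpose_comp_left (f : M' ⟶ M) (k : tensorObj L M ⟶ N) :
    transpose (tensorMap (𝟙 L) f ≫ k) = f ≫ transpose k :=
  hom_ext fun b _ => homObj_ext fun a c => by
    rw [tens_le_transpose, comp_apply, comp_apply, tensorMap_tens, id_apply, tens_le_transpose]

theorem transpose_comp_first (f : L' ⟶ L) (k : tensorObj L M ⟶ N) :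
    transpose (tensorMap f (𝟙 M) ≫ k) = transpose k ≫ homMap f (𝟙 N) :=
  hom_ext fun b _ => homObj_ext fun a c => by
    rw [tens_le_transpose, comp_apply, comp_apply, tensorMap_tens, id_apply, tens_le_homMap,
      opMap_id, id_apply, tens_le_transpose]

theorem transpose_comp_right (k : tensorObj L M ⟶ N) (g : N ⟶ M') :
    transpose (k ≫ g) = transpose k ≫ homMap (𝟙 L) g :=
  hom_ext fun b _ => homObj_ext fun a c => by
    rw [tens_le_transpose, comp_apply, comp_apply, tens_le_homMap, id_apply]
    -- The inequality `g (k (a ⊗ b)) ≤ c` is moved to `k (a ⊗ b) ≤ g° c`.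
    exact (opMap_le g (toOp M' c) (toOp N (k.toFun (tens a b)))).symm.trans
      (tens_le_transpose k a b (ofOp N ((opMap g).toFun (toOp M' c)))).symm

/-- The adjunction `L ⊛ - ⊣ L ⊸ -`. -/
noncomputable def tensorAdjunction (L : CalSym.{u}) :
    tensorLeft L ⊣ homFunctor.obj (Opposite.op L) :=
  Adjunction.mkOfHomEquiv
    { homEquiv := transposeEquiv L
      homEquiv_naturality_left_symm := fun {X' _ Y} f g =>
        (transposeEquiv L X' Y).symm_apply_eq.2
          ((congrArg (f ≫ ·) (transpose_tensorMap_eval (L := L) (N := Y) g)).symm.trans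
            (transpose_comp_left f (tensorMap (𝟙 L) g ≫ eval L Y)).symm)
      homEquiv_naturality_right := fun f g => transpose_comp_right f g }

/-! ### Agreement with Mathlib's currying and internal hom -/

noncomputable instance : MonoidalClosed CalSym.{u} where
  closed L := { rightAdj := homFunctor.obj (Opposite.op L), adj := tensorAdjunction L }

/-- Currying unfolds to the unit `transpose (𝟙 _)` followed by the hom functor applied to `k`, so
naturality in the target applies. -/
theorem curry_eq_transpose (k : tensorObj L M ⟶ N) :
    MonoidalClosed.curry (A := L) (Y := M) (X := N) k = transpose k :=
  (transpose_comp_right (𝟙 (tensorObj L M)) k).symm.trans (by rw [Category.id_comp])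

theorem uncurry_eq (g : M ⟶ homObj L N) :
    MonoidalClosed.uncurry (A := L) (X := N) g = tensorMap (𝟙 L) g ≫ eval L N :=
  ((MonoidalClosed.curry_eq_iff (A := L) (Y := M) (X := N) _ g).1
    ((curry_eq_transpose _).trans (transpose_tensorMap_eval g))).symm

theorem uncurry_id (L N : CalSym.{u}) :
    MonoidalClosed.uncurry (A := L) (X := N) (𝟙 (homObj L N)) = eval L N :=
  (uncurry_eq (𝟙 (homObj L N))).trans (by rw [tensorMap_id, Category.id_comp])

/-- The uncurried form of `pre f` is `f ⊛ 𝟙` followed by `eval`; naturality in the first variable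
applies, and `eval` transposes to the identity. -/
theorem pre_app (f : L' ⟶ L) (N : CalSym.{u}) :
    (MonoidalClosed.pre f).app N = homMap f (𝟙 N) := by
  have h : (MonoidalClosed.pre f).app N = transpose (tensorMap f (𝟙 (homObj L N)) ≫ eval L N) :=
    (MonoidalClosed.curry_uncurry (A := L') (X := homObj L N) (Y := N)
      ((MonoidalClosed.pre f).app N)).symm.trans
      ((congrArg _ ((MonoidalClosed.uncurry_pre f N).trans (congrArg (tensorMap f (𝟙 _) ≫ ·)
        ((MonoidalClosed.uncurry_id_eq_ev L N).symm.trans (uncurry_id L N))))).trans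
        (curry_eq_transpose _))
  rw [h, transpose_comp_first]
  refine (congrArg (· ≫ homMap f (𝟙 N)) (?_ : transpose (eval L N) = 𝟙 (homObj L N))).trans
    (Category.id_comp _)
  have := transpose_tensorMap_eval (𝟙 (homObj L N))
  rwa [tensorMap_id, Category.id_comp] at this

theorem internalHom_eq : MonoidalClosed.internalHom (C := CalSym.{u}) = homFunctor := by
  refine CategoryTheory.Functor.ext (fun _ => rfl) fun X Y f => ?_
  ext N
  refine (pre_app f.unop N).trans ?_
  simp
  rfl

theorem tensor_eq : MonoidalCategory.tensor CalSym.{u} = tensorFunctor := rfl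

end closed

/-! ## The dualizing object -/

section dualizing

variable {L M : CalSym.{u}}

/-- Every atom under `b` is some `f a` with `a ≤ f° b`, so `b = f (f° b)` and `f` is an order
isomorphism. Its inverse then preserves joins, atoms and coatoms. -/
theorem isIso_of_surjective_on_atoms (f : L ⟶ M) (hf : ∀ a b, f.toFun a ≤ f.toFun b → a ≤ b)
    (hs : ∀ q : M, IsAtom q → ∃ a, f.toFun a = q) : IsIso f := by
  have hs' : Function.Surjective f.toFun := fun b => by
    refine ⟨circ f.toFun b, le_antisymm ((circ_gc f.toFun).l_u_le b) ?_⟩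
    refine le_iff_atom_le_imp.2 fun q hq hqb => ?_
    obtain ⟨a, rfl⟩ := hs q hq
    exact OrderHomClass.mono f.toFun ((f.map_le_iff a b).1 hqb)
  let e : L ≃o M := RelIso.ofSurjective
    (OrderEmbedding.ofMapLEIff f.toFun fun a b =>
      ⟨hf a b, fun h => OrderHomClass.mono f.toFun h⟩) hs'
  let g : M ⟶ L :=
    { toFun := { toFun := e.symm, map_sSup' := fun s => by rw [e.symm.map_sSup, sSup_image] }
      atom := fun p hp => Or.inl ((e.symm.isAtom_iff p).2 hp)
      coatom := fun x hx => by
        have : circ e.symm x = e x := congrFun (circ_eq_of_gc e.symm.to_galoisConnection) x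
        left
        change IsCoatom (circ e.symm x)
        rw [this]
        exact (e.isCoatom_iff x).2 hx }
  exact ⟨g, hom_ext fun p _ => e.symm_apply_apply p, hom_ext fun p _ => e.apply_symm_apply p⟩

theorem toDoubleDual_eq (L N : CalSym.{u}) : toDoubleDual N L =
    transpose (L := homObj L N) (braid (homObj L N) L ≫ eval L N) :=
  (curry_eq_transpose (L := homObj L N) (M := L) (N := N) _).trans
    (congrArg (fun k => transpose (L := homObj L N) (braid (homObj L N) L ≫ k)) (uncurry_id L N))

theorem tens_le_toDoubleDual (N : CalSym.{u}) (a : L) (Z : homObj L N) (c : N) :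
    tens (L := homObj L N) Z (toOp N c) ≤
        ofOp (tensorObj (homObj L N) N.op) ((toDoubleDual N L).toFun a) ↔
      tens a (toOp N c) ≤ ofOp (tensorObj L N.op) Z := by
  rw [toDoubleDual_eq]
  refine (tens_le_transpose _ _ _ _).trans ?_
  rw [comp_apply, braid_tens, eval_tens_le]

/-- The atom of the dual of the two-element lattice. -/
noncomputable def twoOpAtom : Atoms two.{u}.op :=
  ⟨toOp two ⊥, isAtom_toOp (isCoatom_bot (α := ULift.{u} Bool))⟩

theorem eq_twoOpAtom (t : Atoms two.{u}.op) : t = twoOpAtom :=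
  Subtype.ext ((isAtom_iff_eq_top (α := (ULift.{u} Bool)ᵒᵈ)).1 t.2)

/-- The relation `Σ[y] × {t}`, with `t` the only atom of `2^op`, is the functional that detects the
coatom `y`. -/
theorem exists_tens_twoOpAtom_le_iff {y : L} (hy : IsCoatom y) :
    ∃ R : tensorObj L two.op, ∀ a, tens a twoOpAtom.1 ≤ R ↔ a ≤ y := by
  obtain ⟨R, -, e⟩ := mem_ClCoatoms_tensor (L := L) (M := two.op)
    (S := {P | (Atoms.fst P).1 ≤ y})
    (fun q => by
      simp only [Set.mem_ofPred_eq, Atoms.fst_tens]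
      exact ⟨y, Or.inl hy, rfl⟩)
    (fun p => mem_ClCoatoms_of_isSimpleOrder (T := (ULift.{u} Bool)ᵒᵈ) _)
  refine ⟨R, fun a => (sSupHom_le_iff_atoms (tensLeft twoOpAtom.1)).trans
    (Iff.trans (forall₃_congr fun p hp _ => ?_) le_iff_atom_le_imp.symm)⟩
  have := Set.ext_iff.1 e ⟨_, isAtom_tens hp twoOpAtom.2⟩
  refine this.symm.trans ?_
  change (Atoms.fst ⟨_, isAtom_tens (⟨p, hp⟩ : Atoms L).2 twoOpAtom.2⟩).1 ≤ y ↔ _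
  rw [Atoms.fst_tens]

theorem isIso_toDoubleDual (L : CalSym.{u}) : IsIso (toDoubleDual two L) := by
  have key : ∀ (a : L) (Z : homObj L two), tens (L := homObj L two) Z twoOpAtom.1 ≤
      ofOp (tensorObj (homObj L two) two.op) ((toDoubleDual two L).toFun a) ↔
        tens a twoOpAtom.1 ≤ ofOp (tensorObj L two.op) Z :=
    fun a Z => tens_le_toDoubleDual two a Z ⊥
  refine isIso_of_surjective_on_atoms _ (fun a b hab => ?_) fun W hW => ?_
  -- Order reflection: a coatom above `b` is detected by a functional, and the hypothesis carries
  -- that test from `b` to `a`.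
  · refine le_iff_coatoms.2 fun y hy hby => ?_
    obtain ⟨R, hR⟩ := exists_tens_twoOpAtom_le_iff hy
    exact (hR a).1 ((key a (toOp _ R)).1 (((key b (toOp _ R)).2 ((hR b).2 hby)).trans hab))
  -- An atom `W` of the double dual is a coatom of `(L ⊸ 2) ⊛ 2^op`, determined by its one slice,
  -- the atoms under `y`. In `L ⊛ 2^op` this `y` is an atom `p ⊗ t` or bottom, whence the preimage
  -- `p` or `⊥`.
  · obtain ⟨y, hy, e⟩ := slice₁_mem (isCoatom_ofOp hW) twoOpAtom
    have hp : ∃ a : L, tens a twoOpAtom.1 = ofOp (tensorObj L two.op) y := by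
      rcases hy with hy | rfl
      · obtain ⟨p, t, h⟩ := exists_tens_of_isAtom (isAtom_ofOp hy)
        rw [eq_twoOpAtom t] at h
        exact ⟨p.1, h.symm⟩
      · exact ⟨⊥, bot_tens _⟩
    obtain ⟨a, ha⟩ := hp
    refine ⟨a, tensor_ext (L := homObj L two) (M := two.op) fun Z t => ?_⟩
    rw [eq_twoOpAtom t]
    refine (key a Z.1).trans ?_
    rw [ha]
    exact (Set.ext_iff.1 e Z).symm

end dualizing

end CalSym

theorem theorem5p5 :
    IsStarAutonomous CalSym.{u} CalSym.tensorFunctor CalSym.two CalSym.homFunctor CalSym.two :=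
  ⟨inferInstance, inferInstance, inferInstance, CalSym.tensor_eq, rfl, CalSym.internalHom_eq,
    CalSym.isIso_toDoubleDual⟩
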